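/- Conventions. Everything is smooth. On $\mathbb{R}^{1,4}=\mathbb{R}\times\mathbb{R}^4$ put $\langle (t,x),(s,y)\rangle=-ts+x\cdot y$. A surface $\hat x:U\to\mathbb{S}^3\subset\mathbb{R}^4$ is an immersion of an open set $U\subset\mathbb{R}^2$ together with a unit normal field $\mathbf{n}$ tangent to $\mathbb{S}^3$; $I=\langle d\hat x,d\hat x\rangle$, $II=-\langle d\hat x,d\mathbf{n}\rangle$, $H=\frac12\mathrm{tr}_I II$ and $\overset{\circ}{II}=II-H\,I$ ($2\times 2$ matrices in the coordinates $(u^1,u^2)$); a point is umbilic if $\overset{\circ}{II}=0$ there. Put $y=(1,\hat x)$; the conformal Gauss map is $\xi=H\,y+(0,\mathbf{n})$. If there are no umbilic points, the conformal transform $\hat x^*:U\to\mathbb{S}^3$ is determined by the condition that for some $\mu>0$ the null vector $y^*=\mu(1,\hat x^*)$ satisfies $\langle y^*,y\rangle=-1$ and $\langle y^*,\xi\rangle=\langle y^*,\xi_{u^1}\rangle=\langle y^*,\xi_{u^2}\rangle=0$; thus $y^*=\frac{1}{1-\hat x\cdot\hat x^*}(1,\hat x^*)$. Theorem. Let $D\subset\mathbb{R}^2$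 be a domain with the following data on it: a traceless symmetric 2-form $\Omega=(\Omega_{ij})$ (so $\Omega_{11}+\Omega_{22}=0$), positive functions $m$ and $E$ with $m=-\det\Omega/E$ (each of $m$, $E$ determines the other), a 1-form $\omega=\omega_1du^1+\omega_2du^2$, and a symmetric 2-form $\Omega^*=(\Omega^*_{ij})$. Let indices after a comma denote covariant differentiation with respect to $E|du|^2$, let $|\Omega|^2=E^{-2}\sum_{i,j}\Omega_{ij}^2$, and let $\mathcal{K}=-\frac{1}{2m}(\partial_{u^1}^2+\partial_{u^2}^2)\log m$ be the Gaussian curvature of $m|du|^2$. Suppose that on $D$ $$\begin{aligned} \Omega_{11,2}-\Omega_{12,1}&=\omega_1\Omega_{12}-\omega_2\Omega_{11},\\ \Omega_{12,2}-\Omega_{22,1}&=\omega_1\Omega_{22}-\omega_2\Omega_{12},\\ \Omega^*_{11,2}-\Omega^*_{12,1}&=-\omega_1\Omega^*_{12}+\omega_2\Omega^*_{11}+\tfrac12\frac{\Omega^*_{11}+\Omega^*_{22}}{|\Omega|^2}(|\Omega|^2)_{u^2},\\ \Omega^*_{12,2}-\Omega^*_{22,1}&=-\omega_1\Omega^*_{22}+\omega_2\Omega^*_{12}-\tfrac12\frac{\Omega^*_{11}+\Omega^*_{22}}{|\Omega|^2}(|\Omega|^2)_{u^1},\\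 \omega_{1,2}-\omega_{2,1}&=\tfrac1m\big((\Omega_{11}-\Omega_{22})\Omega^*_{12}-(\Omega^*_{11}-\Omega^*_{22})\Omega_{12}\big),\\ \mathcal{K}-1&=\tfrac1{m^2}\mathrm{Tr}(\Omega\Omega^*). \end{aligned}$$ Then for every $p_0\in D$ there are a connected open neighborhood $D_0\subset D$ of $p_0$, a surface $\hat x:D_0\to\mathbb{S}^3$ without umbilic points, and a positive function $\hat\lambda$ on $D_0$ with $\hat\lambda(p_0)=1$, such that on $D_0$ 1. $\Omega=\hat\lambda\,\overset{\circ}{II}$; 2. $\langle d\xi,d\xi\rangle=m|du|^2$; 3. $\omega=-I\big((\overset{\circ}{II})^{-1}(dH)\big)-d\log\hat\lambda$, that is, $\omega_i=-\sum_{j,k}I_{ij}\big((\overset{\circ}{II})^{-1}\big)_{jk}H_{u^k}-(\log\hat\lambda)_{u^i}$; 4. $\Omega^*=-\hat\lambda^{-1}\langle d\xi,dy^*\rangle$, that is, $\Omega^*_{ij}=-\hat\lambda^{-1}\langle\xi_{u^i},y^*_{u^j}\rangle$. Moreover $\hat x$ is unique up to a conformal transformation: if $(\hat x,\hat\lambda)$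 and $(\hat x',\hat\lambda')$ both have these properties on a connected open neighborhood $D_0\subset D$ of $p_0$, then $\hat x'=\phi\circ\hat x$ on $D_0$ for some conformal diffeomorphism $\phi$ of $\mathbb{S}^3$ (orientation preserving or reversing). -/

import Mathlib

open scoped ContDiff Manifold InnerProductSpace

namespace ConformalSurface

noncomputable section

/-! ### Ambient spaces -/

/-- The parameter plane, with coordinates `(u¹, u²)` indexed by `0, 1`. -/
abbrev Plane := EuclideanSpace ℝ (Fin 2)

/-- Euclidean 4-space. -/
abbrev E4 := EuclideanSpace ℝ (Fin 4)

/-- The standard round unit 3-sphere in `E4`. -/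
abbrev S3 := Metric.sphere (0 : E4) 1

/-- Minkowski 5-spacetime: pairs `(t, x)` with `t` real and `x` in `E4`. -/
abbrev Minkowski := ℝ × E4

/-- The Lorentz inner product `-ts + x·y`. -/
def lorentz (v w : Minkowski) : ℝ := -(v.1 * w.1) + ⟪v.2, w.2⟫_ℝ

/-- The partial derivative `∂f/∂uⁱ`. -/
def pd {F : Type*} [NormedAddCommGroup F] [NormedSpace ℝ F] (i : Fin 2) (f : Plane → F)
    (u : Plane) : F :=
  fderiv ℝ f u (EuclideanSpace.single i 1)

/-! ### Tensor calculus in isothermal coordinates -/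

/-- The Christoffel symbol `Γᵏᵢⱼ` of the metric `E |du|²`. -/
def christoffel (E : Plane → ℝ) (k i j : Fin 2) (u : Plane) : ℝ :=
  ((if j = k then pd i E u else 0) + (if i = k then pd j E u else 0)
    - (if i = j then pd k E u else 0)) / (2 * E u)

/-- The component `T_{ij,k}` of the covariant derivative of the 2-tensor `T` with respect to the
Levi-Civita connection of `E |du|²`. -/
def covDeriv (E : Plane → ℝ) (T : Plane → Matrix (Fin 2) (Fin 2) ℝ) (i j k : Fin 2)
    (u : Plane) : ℝ :=
  pd k (fun v => T v i j) u
    - ∑ l, (christoffel E l k i u * T u l j + christoffel E l k j u * T u i l)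

/-- The squared norm `|T|²` of a 2-tensor `T` with respect to `E |du|²`. -/
def normSq (E : Plane → ℝ) (T : Plane → Matrix (Fin 2) (Fin 2) ℝ) (u : Plane) : ℝ :=
  (∑ i, ∑ j, T u i j ^ 2) / E u ^ 2

/-- The Gaussian curvature `-(Δ₀ log m) / (2m)` of the metric `m |du|²`. -/
def gaussCurvature (m : Plane → ℝ) (u : Plane) : ℝ :=
  -(pd 0 (pd 0 fun v => Real.log (m v)) u + pd 1 (pd 1 fun v => Real.log (m v)) u) / (2 * m u)

/-! ### The given data -/

/-- Smooth data on `D`: a traceless symmetric 2-form `Ω`, positive functions `m` and `E` with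
`m = -det Ω / E`, a 1-form `w` and a symmetric 2-form `Ωs`. -/
structure IsData (D : Set Plane) (Ω : Plane → Matrix (Fin 2) (Fin 2) ℝ) (m E : Plane → ℝ)
    (w : Plane → Fin 2 → ℝ) (Ωs : Plane → Matrix (Fin 2) (Fin 2) ℝ) : Prop where
  smooth_Ω : ∀ i j, ContDiffOn ℝ ∞ (fun u => Ω u i j) D
  smooth_m : ContDiffOn ℝ ∞ m D
  smooth_w : ∀ i, ContDiffOn ℝ ∞ (fun u => w u i) D
  smooth_Ωs : ∀ i j, ContDiffOn ℝ ∞ (fun u => Ωs u i j) D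
  symm_Ω : ∀ u ∈ D, (Ω u).IsSymm
  trace_Ω : ∀ u ∈ D, (Ω u).trace = 0
  pos_m : ∀ u ∈ D, 0 < m u
  pos_E : ∀ u ∈ D, 0 < E u
  m_eq : ∀ u ∈ D, m u = -(Ω u).det / E u
  symm_Ωs : ∀ u ∈ D, (Ωs u).IsSymm

/-- The six integrability (Gauss–Codazzi) equations at the point `u`. A comma followed by an index
is covariant differentiation with respect to `E |du|²` for the 2-tensors `Ω`, `Ωs`; in the
antisymmetrized derivative of the 1-form `w` the Christoffel symbols cancel. -/
structure IntegrabilityConditions (Ω : Plane → Matrix (Fin 2) (Fin 2) ℝ) (m E : Plane → ℝ)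
    (w : Plane → Fin 2 → ℝ) (Ωs : Plane → Matrix (Fin 2) (Fin 2) ℝ) (u : Plane) : Prop where
  codazzi₁ : covDeriv E Ω 0 0 1 u - covDeriv E Ω 0 1 0 u = w u 0 * Ω u 0 1 - w u 1 * Ω u 0 0
  codazzi₂ : covDeriv E Ω 0 1 1 u - covDeriv E Ω 1 1 0 u = w u 0 * Ω u 1 1 - w u 1 * Ω u 0 1
  codazziStar₁ : covDeriv E Ωs 0 0 1 u - covDeriv E Ωs 0 1 0 u =
    -(w u 0 * Ωs u 0 1) + w u 1 * Ωs u 0 0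
      + 1 / 2 * ((Ωs u 0 0 + Ωs u 1 1) / normSq E Ω u) * pd 1 (normSq E Ω) u
  codazziStar₂ : covDeriv E Ωs 0 1 1 u - covDeriv E Ωs 1 1 0 u =
    -(w u 0 * Ωs u 1 1) + w u 1 * Ωs u 0 1
      - 1 / 2 * ((Ωs u 0 0 + Ωs u 1 1) / normSq E Ω u) * pd 0 (normSq E Ω) u
  codazziMixed : pd 1 (fun v => w v 0) u - pd 0 (fun v => w v 1) u =
    1 / m u * ((Ω u 0 0 - Ω u 1 1) * Ωs u 0 1 - (Ωs u 0 0 - Ωs u 1 1) * Ω u 0 1)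
  gauss : gaussCurvature m u - 1 = 1 / m u ^ 2 * (Ω u * Ωs u).trace

/-! ### Surfaces in the 3-sphere -/

/-- `x` is a smooth immersed parametrized surface in `S3` over `U`, and `n` is a smooth unit normal
field of it (tangent to the sphere). -/
structure IsSurface (U : Set Plane) (x : Plane → S3) (n : Plane → E4) : Prop where
  smooth_x : ContDiffOn ℝ ∞ (fun u => (x u : E4)) U
  smooth_n : ContDiffOn ℝ ∞ n U
  immersion : ∀ u ∈ U, LinearIndependent ℝ fun i => pd i (fun v => (x v : E4)) u
  norm_n : ∀ u ∈ U, ‖n u‖ = 1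
  n_perp_x : ∀ u ∈ U, ⟪n u, (x u : E4)⟫_ℝ = 0
  n_perp_dx : ∀ u ∈ U, ∀ i, ⟪n u, pd i (fun v => (x v : E4)) u⟫_ℝ = 0

/-- The matrix of the first fundamental form `I = ⟨dx, dx⟩`. -/
def firstForm (x : Plane → S3) (u : Plane) : Matrix (Fin 2) (Fin 2) ℝ :=
  Matrix.of fun i j => ⟪pd i (fun v => (x v : E4)) u, pd j (fun v => (x v : E4)) u⟫_ℝ

/-- The matrix of the second fundamental form `II = -⟨dx, dn⟩`. -/
def secondForm (x : Plane → S3) (n : Plane → E4) (u : Plane) : Matrix (Fin 2) (Fin 2) ℝ :=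
  Matrix.of fun i j => -⟪pd i (fun v => (x v : E4)) u, pd j n u⟫_ℝ

/-- The mean curvature `H`, half the trace of `II` with respect to `I`. -/
def meanCurvature (x : Plane → S3) (n : Plane → E4) (u : Plane) : ℝ :=
  1 / 2 * ((firstForm x u)⁻¹ * secondForm x n u).trace

/-- The traceless part `II - H I` of the second fundamental form. -/
def tracelessSecondForm (x : Plane → S3) (n : Plane → E4) (u : Plane) :
    Matrix (Fin 2) (Fin 2) ℝ :=
  secondForm x n u - meanCurvature x n u • firstForm x u

/-- There is no umbilical point over `U`. -/
def NoUmbilic (U : Set Plane) (x : Plane → S3) (n : Plane → E4) : Prop :=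
  ∀ u ∈ U, tracelessSecondForm x n u ≠ 0

/-- The null lift `(1, x)` of a point `x` of the sphere. -/
def nullLift (x : S3) : Minkowski := (1, (x : E4))

/-- The conformal Gauss map `ξ = H (1, x) + (0, n)`. -/
def conformalGauss (x : Plane → S3) (n : Plane → E4) (u : Plane) : Minkowski :=
  meanCurvature x n u • nullLift (x u) + ((0, n u) : Minkowski)

/-- `xs` is the conformal transform of the surface `x` over `U`: for some `μ > 0` the null vector
`y* = μ (1, xs)` satisfies `⟨y*, y⟩ = -1` for `y = (1, x)`, and is orthogonal to the conformal Gauss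
map `ξ` and to `ξ_{u¹}`, `ξ_{u²}`. -/
structure IsConformalTransform (U : Set Plane) (x : Plane → S3) (n : Plane → E4)
    (xs : Plane → S3) : Prop where
  smooth : ContDiffOn ℝ ∞ (fun u => (xs u : E4)) U
  exists_scale : ∀ u ∈ U, ∃ μ : ℝ, 0 < μ ∧
    lorentz (μ • nullLift (xs u)) (nullLift (x u)) = -1 ∧
    lorentz (μ • nullLift (xs u)) (μ • nullLift (xs u)) = 0 ∧
    lorentz (μ • nullLift (xs u)) (conformalGauss x n u) = 0 ∧
    ∀ i, lorentz (μ • nullLift (xs u)) (pd i (conformalGauss x n) u) = 0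

/-- The null normal `y* = (1, xs) / (1 - x · xs)`. -/
def yStar (x xs : Plane → S3) (u : Plane) : Minkowski :=
  (1 / (1 - ⟪(x u : E4), (xs u : E4)⟫_ℝ)) • nullLift (xs u)

/-- The surface `x` with unit normal field `n` has no umbilical point over `U` and, together with
the positive function `lam` normalized at `p₀`, realizes the data `Ω`, `m`, `w`, `Ωs` over `U`. -/
structure Realizes (U : Set Plane) (p₀ : Plane) (Ω : Plane → Matrix (Fin 2) (Fin 2) ℝ)
    (m : Plane → ℝ) (w : Plane → Fin 2 → ℝ) (Ωs : Plane → Matrix (Fin 2) (Fin 2) ℝ)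
    (x : Plane → S3) (n : Plane → E4) (lam : Plane → ℝ) : Prop where
  surface : IsSurface U x n
  noUmbilic : NoUmbilic U x n
  smooth_lam : ContDiffOn ℝ ∞ lam U
  pos_lam : ∀ u ∈ U, 0 < lam u
  lam_base : lam p₀ = 1
  Ω_eq : ∀ u ∈ U, Ω u = lam u • tracelessSecondForm x n u
  mobius_eq : ∀ u ∈ U, ∀ i j, lorentz (pd i (conformalGauss x n) u) (pd j (conformalGauss x n) u) =
    if i = j then m u else 0
  w_eq : ∀ u ∈ U, ∀ i, w u i =
    -((firstForm x u).mulVec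
        ((tracelessSecondForm x n u)⁻¹.mulVec fun j => pd j (meanCurvature x n) u) i)
      - pd i (fun v => Real.log (lam v)) u
  Ωs_eq : ∃ xs : Plane → S3, IsConformalTransform U x n xs ∧ ∀ u ∈ U, ∀ i j,
    Ωs u i j = -((lam u)⁻¹ * lorentz (pd i (conformalGauss x n) u) (pd j (yStar x xs) u))

/-- A diffeomorphism `φ` of the round 3-sphere is a conformal transformation when its differential
at each point multiplies the round metric by a positive factor. -/
def IsConformal (φ : S3 ≃ₘ⟮𝓡 3, 𝓡 3⟯ S3) : Prop :=
  ∀ p : S3, ∃ c : ℝ, 0 < c ∧ ∀ v w : TangentSpace (𝓡 3) p,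
    ⟪mvfderiv (𝓡 3) (fun q : S3 => (φ q : E4)) p v,
      mvfderiv (𝓡 3) (fun q : S3 => (φ q : E4)) p w⟫_ℝ =
    c * ⟪mvfderiv (𝓡 3) (fun q : S3 => (q : E4)) p v,
      mvfderiv (𝓡 3) (fun q : S3 => (q : E4)) p w⟫_ℝ

end

end ConformalSurface

open ConformalSurface

open scoped ContDiff Manifold InnerProductSpace

/-! This is a fundamental theorem of surface theory for a moving frame in Minkowski space. For a
surface that realizes the data, put `Y = λ(1, x)` and `Y* = λ⁻¹ y*`. Together with `ξ` and its two
derivatives these form a frame whose Gram matrix depends on `m` alone (`MovingFrame.IsAdapted`). Its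
derivatives are linear in the frame, with coefficients made of `m`, `Ω`, `w`, `Ωs`
(`MovingFrame.IsSolution`).

The resulting linear system is overdetermined. Its zero curvature condition consists of the six
given equations, once `E` has been eliminated from them (`IsData.flatIntegrability`), and of the
symmetry of the second derivatives of `log m`; see `connection_integrable`. A Frobenius theorem,
proved by solving along rays, then gives a local solution with any prescribed value at `p₀`.

The coefficients are skew for the Gram matrix of an adapted frame. Hence the linear map `transition`
from one solution to another is constant (`pd_transition`), whether or not the frames are adapted.
This serves twice. Taken from a solution to itself, it is the identity at `p₀` and so everywhere,
which says that the frame stays adapted. Taken between the frames of two surfaces, it is a Lorentz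
transformation independent of the point.

For existence, the surface is read off from an adapted solution: `λ` and `H` are the time components
of `Y` and `ξ`, the point `x` is the direction of `Y`, and the normal is `ξ - H(1, x)`
(`realizes_of_adapted_solution`). For uniqueness, the frame of any realization is an adapted
solution (`Realizes.isAdapted`, `Realizes.isSolution`), so a Lorentz transformation carries `Y` to
`Y'`. Positivity of the two scale factors makes it preserve the future cone, and it induces a
conformal map of the sphere of null directions (`exists_conformal_of_isometry`). -/

namespace ConformalSurface

noncomputable section

/-! ### Frobenius theorem for linear total differential systems. -/

section Frobenius

set_option maxSynthPendingDepth 3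

variable {E W : Type*} [NormedAddCommGroup E] [NormedSpace ℝ E]
  [NormedAddCommGroup W] [NormedSpace ℝ W]

/-- A linear ODE on `[0, 1]` with coefficient of norm at most `1 / 2` has a solution. -/
theorem exists_linear_ode_solution [CompleteSpace W] {B : ℝ → W →L[ℝ] W}
    (hB : ContinuousOn B (Set.Icc 0 1)) (hb : ∀ t ∈ Set.Icc (0 : ℝ) 1, ‖B t‖ ≤ 1 / 2) (F₀ : W) :
    ∃ f : ℝ → W, f 0 = F₀ ∧
      ∀ t ∈ Set.Icc (0 : ℝ) 1, HasDerivWithinAt f (B t (f t)) (Set.Icc 0 1) t := by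
  -- On the ball of radius `‖F₀‖` about `F₀` one has `‖x‖ ≤ 2‖F₀‖`, so the bound `1 / 2` on the
  -- coefficient makes the speed at most `‖F₀‖` and the solution stays in the ball up to time 1.
  have hpl : IsPicardLindelof (fun t x => B t x) (tmin := 0) (tmax := 1) ⟨0, by simp⟩ F₀ ‖F₀‖₊ 0
      ‖F₀‖₊ (1 / 2) :=
    { lipschitzOnWith := fun t ht => by
        refine LipschitzWith.lipschitzOnWith (LipschitzWith.of_dist_le_mul fun x y => ?_)
        rw [dist_eq_norm, dist_eq_norm, ← map_sub]
        refine (B t).le_of_opNorm_le ?_ _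
        simpa using hb t ht
      continuousOn := fun x _ => hB.clm_apply continuousOn_const
      norm_le := fun t ht x hx => by
        have h1 : ‖x‖ ≤ 2 * ‖F₀‖ := by
          rw [Metric.mem_closedBall, dist_eq_norm] at hx
          have := norm_le_norm_add_norm_sub' x F₀
          simp only [coe_nnnorm] at hx
          linarith
        calc ‖B t x‖ ≤ 1 / 2 * ‖x‖ := (B t).le_of_opNorm_le (hb t ht) x
          _ ≤ ‖F₀‖ := by linarith
      mul_max_le := by simp }
  exact hpl.exists_eq_forall_mem_Icc_hasDerivWithinAt₀

/-- Second order Taylor estimate on a convex set on which the derivative is Lipschitz. -/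
theorem norm_taylor_two_le {G : Type*} [NormedAddCommGroup G] [NormedSpace ℝ G] {A : E → G}
    {s : Set E} (hs : Convex ℝ s) {M : ℝ} (hA : ∀ x ∈ s, DifferentiableAt ℝ A x)
    (hL : ∀ x ∈ s, ∀ y ∈ s, ‖fderiv ℝ A x - fderiv ℝ A y‖ ≤ M * ‖x - y‖) (hM : 0 ≤ M)
    {x y : E} (hx : x ∈ s) (hy : y ∈ s) :
    ‖A y - A x - fderiv ℝ A x (y - x)‖ ≤ M * ‖y - x‖ ^ 2 := by
  have hseg : segment ℝ x y ⊆ s := hs.segment_subset hx hy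
  have := (convex_segment x y).norm_image_sub_le_of_norm_hasFDerivWithin_le' (f := A)
    (f' := fderiv ℝ A) (φ := fderiv ℝ A x) (C := M * ‖y - x‖)
    (fun z hz => (hA z (hseg hz)).hasFDerivAt.hasFDerivWithinAt) (fun z hz => by
      refine (hL z (hseg hz) x hx).trans ?_
      gcongr
      obtain ⟨t, ht, rfl⟩ := (segment_eq_image' ℝ x y).subset hz
      rw [add_sub_cancel_left, norm_smul, Real.norm_of_nonneg ht.1]
      exact mul_le_of_le_one_left (norm_nonneg _) ht.2)
    (left_mem_segment ℝ x y) (right_mem_segment ℝ x y)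
  rw [pow_two, ← mul_assoc]
  exact this

/-- Solving a completely integrable linear system along the rays issuing from `x₀` gives a solution
of the system. -/
theorem hasFDerivAt_of_radial_solution {A : E → E →L[ℝ] W →L[ℝ] W} {x₀ : E} {ρ M : ℝ}
    (hρ1 : ρ ≤ 1) (hM : 0 < M)
    (hA : ∀ x ∈ Metric.ball x₀ ρ, DifferentiableAt ℝ A x)
    (hAM : ∀ x ∈ Metric.ball x₀ ρ, ‖A x‖ ≤ M)
    (hDM : ∀ x ∈ Metric.ball x₀ ρ, ‖fderiv ℝ A x‖ ≤ M)
    (hL : ∀ x ∈ Metric.ball x₀ ρ, ∀ y ∈ Metric.ball x₀ ρ,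
      ‖fderiv ℝ A x - fderiv ℝ A y‖ ≤ M * ‖x - y‖)
    (hint : ∀ x ∈ Metric.ball x₀ ρ, ∀ u v : E,
      fderiv ℝ A x u v + A x v ∘L A x u = fderiv ℝ A x v u + A x u ∘L A x v)
    {F₀ : W} {f : E → ℝ → W} (hf0 : ∀ u ∈ Metric.ball (0 : E) ρ, f u 0 = F₀)
    (hf : ∀ u ∈ Metric.ball (0 : E) ρ, ∀ t ∈ Set.Icc (0 : ℝ) 1,
      HasDerivWithinAt (f u) (A (x₀ + t • u) u (f u t)) (Set.Icc 0 1) t)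
    {u : E} (hu : u ∈ Metric.ball (0 : E) ρ) :
    HasFDerivAt (fun v => f v 1) ((A (x₀ + u)).flip (f u 1)) u := by
  have hmem : ∀ v ∈ Metric.ball (0 : E) ρ, ∀ t ∈ Set.Icc (0 : ℝ) 1,
      x₀ + t • v ∈ Metric.ball x₀ ρ := by
    intro v hv t ht
    rw [mem_ball_zero_iff] at hv
    rw [Metric.mem_ball, dist_eq_norm, add_sub_cancel_left, norm_smul, Real.norm_of_nonneg ht.1]
    exact (mul_le_of_le_one_left (norm_nonneg _) ht.2).trans_lt hv
  have hcont : ContinuousOn (f u) (Set.Icc 0 1) := fun t ht => (hf u hu t ht).continuousWithinAt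
  obtain ⟨C, hC⟩ := isCompact_Icc.exists_bound_of_continuousOn hcont
  have hC0 : 0 ≤ C := (norm_nonneg _).trans (hC 0 (by simp))
  set c : ℝ := (2 * M + 2 * M * M) * C with hc
  have hc0 : 0 ≤ c := by positivity
  have key : ∀ h : E, u + h ∈ Metric.ball (0 : E) ρ →
      ‖f (u + h) 1 - f u 1 - A (x₀ + u) h (f u 1)‖ ≤ c / M * (Real.exp M - 1) * ‖h‖ ^ 2 := by
    intro h huh
    -- The expected derivative of `f u t` in the direction `h` is `t • A (x₀ + t • u) h (f u t)`.
    -- The deviation `Δ` from it starts at 0 and satisfies `‖Δ'‖ ≤ M‖Δ‖ + c‖h‖²`, so Grönwall makes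
    -- it quadratic in `h`.
    set Δ : ℝ → W := fun t => f (u + h) t - f u t - t • A (x₀ + t • u) h (f u t) with hΔ
    have hd : ∀ t ∈ Set.Icc (0 : ℝ) 1, HasDerivWithinAt Δ
        (A (x₀ + t • (u + h)) (u + h) (f (u + h) t) - A (x₀ + t • u) u (f u t)
          - (t • (fderiv ℝ A (x₀ + t • u) u h (f u t) +
              A (x₀ + t • u) h (A (x₀ + t • u) u (f u t)))
            + (1 : ℝ) • A (x₀ + t • u) h (f u t))) (Set.Icc 0 1) t := by
      intro t ht
      have h1 : HasDerivAt (fun t : ℝ => x₀ + t • u) u t := by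
        simpa using ((hasDerivAt_id t).smul_const u).const_add x₀
      have h2 : HasDerivAt (fun t : ℝ => A (x₀ + t • u)) (fderiv ℝ A (x₀ + t • u) u) t :=
        (hA _ (hmem u hu t ht)).hasFDerivAt.comp_hasDerivAt t h1
      have h3 : HasDerivAt (fun t : ℝ => A (x₀ + t • u) h) (fderiv ℝ A (x₀ + t • u) u h) t := by
        simpa using h2.clm_apply (hasDerivAt_const t h)
      have h4 := h3.hasDerivWithinAt.clm_apply (hf u hu t ht)
      exact ((hf _ huh t ht).sub (hf u hu t ht)).sub ((hasDerivWithinAt_id t _).smul h4)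
    have hcontΔ : ContinuousOn Δ (Set.Icc 0 1) := fun t ht => (hd t ht).continuousWithinAt
    have hgr := norm_le_gronwallBound_of_norm_deriv_right_le (δ := 0) (K := M)
      (ε := c * ‖h‖ ^ 2) hcontΔ
      (fun t ht => ((hd t (Set.Ico_subset_Icc_self ht)).mono_of_mem_nhdsWithin
        (Icc_mem_nhdsGE_of_mem ht))) (by simp [hΔ, hf0 _ huh, hf0 u hu]) ?_ 1 (by simp)
    · rw [gronwallBound_of_K_ne_0 hM.ne'] at hgr
      simp only [hΔ, one_smul, zero_mul, zero_add, sub_zero, mul_one] at hgr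
      refine hgr.trans (le_of_eq ?_)
      ring
    · intro t ht
      replace ht := Set.Ico_subset_Icc_self ht
      set p := x₀ + t • u with hp
      set q := x₀ + t • (u + h) with hq
      have hpm : p ∈ Metric.ball x₀ ρ := hmem u hu t ht
      have hqm : q ∈ Metric.ball x₀ ρ := hmem _ huh t ht
      have hqp : q - p = t • h := by rw [hp, hq]; module
      have hth : ‖q - p‖ ≤ ‖h‖ := by
        rw [hqp, norm_smul, Real.norm_of_nonneg ht.1]
        exact mul_le_of_le_one_left (norm_nonneg _) ht.2
      -- Complete integrability enters only here: it trades the derivative of `A` along the ray,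
      -- evaluated on `h`, for the derivative along `h`, evaluated on `u`. The latter is what the
      -- Taylor expansion of `A q - A p` produces.
      have hI := congrArg (fun L : W →L[ℝ] W => L (f u t)) (hint p hpm u h)
      simp only [_root_.add_apply, ContinuousLinearMap.comp_apply] at hI
      have huh1 : ‖u + h‖ ≤ 1 := by
        rw [mem_ball_zero_iff] at huh; linarith
      have hT : ‖A q - A p - fderiv ℝ A p (q - p)‖ ≤ M * ‖h‖ ^ 2 :=
        (norm_taylor_two_le (convex_ball x₀ ρ) hA hL hM.le hpm hqm).trans (by gcongr)
      have hS : ‖A q - A p‖ ≤ M * ‖h‖ :=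
        ((convex_ball x₀ ρ).norm_image_sub_le_of_norm_fderiv_le hA hDM hpm hqm).trans (by gcongr)
      set R₁ : W →L[ℝ] W := (A q - A p - fderiv ℝ A p (q - p)) (u + h) + t • fderiv ℝ A p h h
      set R₂ : W →L[ℝ] W := (A q - A p) (u + h) + A p h
      have hR₁ : ‖R₁‖ ≤ 2 * M * ‖h‖ ^ 2 := by
        have e1 : ‖(A q - A p - fderiv ℝ A p (q - p)) (u + h)‖ ≤ M * ‖h‖ ^ 2 * 1 :=
          (ContinuousLinearMap.le_opNorm _ _).trans (by gcongr)
        have e2 : ‖t • fderiv ℝ A p h h‖ ≤ 1 * (M * ‖h‖ * ‖h‖) := by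
          rw [norm_smul, Real.norm_of_nonneg ht.1]
          have : ‖fderiv ℝ A p h h‖ ≤ M * ‖h‖ * ‖h‖ :=
            ((fderiv ℝ A p).le_opNorm₂ h h).trans (by gcongr; exact hDM p hpm)
          exact mul_le_mul ht.2 this (norm_nonneg _) zero_le_one
        exact (norm_add_le _ _).trans (by nlinarith)
      have hR₂ : ‖R₂‖ ≤ 2 * M * ‖h‖ := by
        have e1 : ‖(A q - A p) (u + h)‖ ≤ M * ‖h‖ * 1 :=
          (ContinuousLinearMap.le_opNorm _ _).trans (by gcongr)
        have e2 : ‖A p h‖ ≤ M * ‖h‖ := (A p).le_of_opNorm_le (hAM p hpm) h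
        exact (norm_add_le _ _).trans (by linarith)
      -- `R₁` is already quadratic in `h`; `R₂` is linear in `h` and acts on a vector that is linear
      -- in `h`.
      have hdecomp : A q (u + h) (f (u + h) t) - A p u (f u t)
          - (t • (fderiv ℝ A p u h (f u t) + A p h (A p u (f u t))) + (1 : ℝ) • A p h (f u t)) =
          A q (u + h) (Δ t) + (R₁ (f u t) + t • R₂ (A p h (f u t))) := by
        rw [hI]
        simp only [hΔ, R₁, R₂, hqp, map_add, map_sub, map_smul, _root_.add_apply,
          _root_.sub_apply, _root_.smul_apply, ← hp]
        module
      rw [hdecomp]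
      have n1 : ‖A q (u + h) (Δ t)‖ ≤ M * ‖Δ t‖ := by
        have : ‖A q (u + h)‖ ≤ M * 1 := ((A q).le_opNorm _).trans (by gcongr; exact hAM q hqm)
        simpa using (A q (u + h)).le_of_opNorm_le this (Δ t)
      have n2 : ‖R₁ (f u t)‖ ≤ 2 * M * ‖h‖ ^ 2 * C :=
        (R₁.le_opNorm _).trans (by gcongr; exact hC t ht)
      have n3 : ‖t • R₂ (A p h (f u t))‖ ≤ 1 * (2 * M * ‖h‖ * (M * ‖h‖ * C)) := by
        rw [norm_smul, Real.norm_of_nonneg ht.1]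
        have e : ‖A p h (f u t)‖ ≤ M * ‖h‖ * C :=
          ((A p).le_opNorm₂ _ _).trans (by gcongr; exacts [hAM p hpm, hC t ht])
        have : ‖R₂ (A p h (f u t))‖ ≤ 2 * M * ‖h‖ * (M * ‖h‖ * C) :=
          (R₂.le_opNorm _).trans (by gcongr)
        exact mul_le_mul ht.2 this (norm_nonneg _) zero_le_one
      calc _ ≤ ‖A q (u + h) (Δ t)‖ + (‖R₁ (f u t)‖ + ‖t • R₂ (A p h (f u t))‖) :=
            (norm_add_le _ _).trans (by gcongr; exact norm_add_le _ _)
        _ ≤ M * ‖Δ t‖ + c * ‖h‖ ^ 2 := by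
            rw [hc]
            nlinarith
  rw [hasFDerivAt_iff_isLittleO_nhds_zero]
  have hO : (fun h : E => f (u + h) 1 - f u 1 - ((A (x₀ + u)).flip (f u 1)) h)
      =O[nhds 0] fun h : E => ‖h‖ ^ 2 := by
    refine Asymptotics.IsBigO.of_bound (c / M * (Real.exp M - 1)) ?_
    have hev : ∀ᶠ h : E in nhds 0, u + h ∈ Metric.ball (0 : E) ρ :=
      (continuous_const.add continuous_id).continuousAt.eventually_mem
        (by simpa using Metric.isOpen_ball.mem_nhds hu)
    filter_upwards [hev] with h hh
    simpa using key h hh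
  refine hO.trans_isLittleO ?_
  simpa using (Asymptotics.isLittleO_norm_pow_id (E' := E) one_lt_two)

/-- **Frobenius theorem** for completely integrable linear systems `dF = A F`. -/
theorem exists_solution_of_integrable [CompleteSpace W] {A : E → E →L[ℝ] W →L[ℝ] W} {U : Set E}
    (hU : IsOpen U) {x₀ : E} (hx₀ : x₀ ∈ U) (hA : ContDiffOn ℝ 2 A U)
    (hint : ∀ x ∈ U, ∀ u v : E,
      fderiv ℝ A x u v + A x v ∘L A x u = fderiv ℝ A x v u + A x u ∘L A x v) (F₀ : W) :
    ∃ ρ > 0, Metric.ball x₀ ρ ⊆ U ∧ ∃ F : E → W, F x₀ = F₀ ∧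
      ∀ x ∈ Metric.ball x₀ ρ, HasFDerivAt F ((A x).flip (F x)) x := by
  have hAt : ContDiffAt ℝ 2 A x₀ := hA.contDiffAt (hU.mem_nhds hx₀)
  have hD : ContDiffAt ℝ 1 (fderiv ℝ A) x₀ := hAt.fderiv_right (m := 1) (by norm_num)
  obtain ⟨K, t, ht, hK⟩ := hD.exists_lipschitzOnWith
  have e1 : ∀ᶠ x in nhds x₀, ‖A x‖ < ‖A x₀‖ + 1 :=
    hAt.continuousAt.norm.eventually_lt continuousAt_const (by simp)
  have e2 : ∀ᶠ x in nhds x₀, ‖fderiv ℝ A x‖ < ‖fderiv ℝ A x₀‖ + 1 :=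
    hD.continuousAt.norm.eventually_lt continuousAt_const (by simp)
  obtain ⟨δ, hδ, hball⟩ := Metric.eventually_nhds_iff_ball.1
    ((e1.and e2).and ((hU.eventually_mem hx₀).and (Filter.eventually_mem_set.2 ht)))
  set M : ℝ := ‖A x₀‖ + ‖fderiv ℝ A x₀‖ + K + 1 with hMdef
  have hM : 0 < M := by positivity
  -- The bound `1 / (2 * M)` makes the radial coefficient at most `1 / 2`, as the ODE lemma
  -- requires; the bound 1 controls `‖u + h‖` in the error estimate.
  set ρ : ℝ := min δ (min 1 (1 / (2 * M)))
  have hρ : 0 < ρ := by positivity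
  have hρδ : ρ ≤ δ := min_le_left _ _
  have hρ1 : ρ ≤ 1 := (min_le_right _ _).trans (min_le_left _ _)
  have hρM : M * ρ ≤ 1 / 2 := by
    have : ρ ≤ 1 / (2 * M) := (min_le_right _ _).trans (min_le_right _ _)
    calc M * ρ ≤ M * (1 / (2 * M)) := by gcongr
      _ = 1 / 2 := by field_simp
  have hb : ∀ x ∈ Metric.ball x₀ ρ, x ∈ Metric.ball x₀ δ := Metric.ball_subset_ball hρδ
  have hsub : Metric.ball x₀ ρ ⊆ U := fun x hx => (hball x (hb x hx)).2.1
  have hAd : ∀ x ∈ Metric.ball x₀ ρ, DifferentiableAt ℝ A x := fun x hx =>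
    (hA.contDiffAt (hU.mem_nhds (hsub hx))).differentiableAt (by norm_num)
  have hAM : ∀ x ∈ Metric.ball x₀ ρ, ‖A x‖ ≤ M := fun x hx => by
    have := (hball x (hb x hx)).1.1
    have h1 := norm_nonneg (fderiv ℝ A x₀)
    have h2 := K.2
    rw [hMdef]; linarith [K.coe_nonneg]
  have hDM : ∀ x ∈ Metric.ball x₀ ρ, ‖fderiv ℝ A x‖ ≤ M := fun x hx => by
    have := (hball x (hb x hx)).1.2
    have h1 := norm_nonneg (A x₀)
    rw [hMdef]; linarith [K.coe_nonneg]
  have hL : ∀ x ∈ Metric.ball x₀ ρ, ∀ y ∈ Metric.ball x₀ ρ,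
      ‖fderiv ℝ A x - fderiv ℝ A y‖ ≤ M * ‖x - y‖ := fun x hx y hy => by
    have := hK.norm_sub_le (hball x (hb x hx)).2.2 (hball y (hb y hy)).2.2
    refine this.trans ?_
    gcongr
    have h1 := norm_nonneg (A x₀)
    have h2 := norm_nonneg (fderiv ℝ A x₀)
    rw [hMdef]; linarith
  have hmem : ∀ v ∈ Metric.ball (0 : E) ρ, ∀ t ∈ Set.Icc (0 : ℝ) 1,
      x₀ + t • v ∈ Metric.ball x₀ ρ := by
    intro v hv t ht
    rw [mem_ball_zero_iff] at hv
    rw [Metric.mem_ball, dist_eq_norm, add_sub_cancel_left, norm_smul, Real.norm_of_nonneg ht.1]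
    exact (mul_le_of_le_one_left (norm_nonneg _) ht.2).trans_lt hv
  have hsol : ∀ u ∈ Metric.ball (0 : E) ρ, ∃ f : ℝ → W, f 0 = F₀ ∧ ∀ t ∈ Set.Icc (0 : ℝ) 1,
      HasDerivWithinAt f (A (x₀ + t • u) u (f t)) (Set.Icc 0 1) t := by
    intro u hu
    refine exists_linear_ode_solution (B := fun t => A (x₀ + t • u) u) ?_ ?_ F₀
    · intro t ht
      have h1 : ContinuousAt (fun t : ℝ => x₀ + t • u) t := by fun_prop
      have h2 : ContinuousAt (fun t : ℝ => A (x₀ + t • u)) t :=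
        ContinuousAt.comp (f := fun t : ℝ => x₀ + t • u) (hAd _ (hmem u hu t ht)).continuousAt h1
      exact (h2.clm_apply continuousAt_const).continuousWithinAt
    · intro t ht
      rw [mem_ball_zero_iff] at hu
      calc ‖A (x₀ + t • u) u‖ ≤ M * ρ :=
            ((A _).le_opNorm u).trans (by gcongr; exact hAM _ (hmem u (by simpa using hu) t ht))
        _ ≤ 1 / 2 := hρM
  choose! f hf0 hf using hsol
  have hder := fun u hu => hasFDerivAt_of_radial_solution (F₀ := F₀) hρ1 hM hAd hAM hDM hL
    (fun x hx => hint x (hsub hx)) hf0 hf (u := u) hu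
  refine ⟨ρ, hρ, hsub, fun x => f (x - x₀) 1, ?_, ?_⟩
  · have h0 : (0 : E) ∈ Metric.ball (0 : E) ρ := Metric.mem_ball_self hρ
    -- At the centre the ray is a point and the ODE has zero right-hand side.
    have hc : ∀ t ∈ Set.Icc (0 : ℝ) 1, f 0 t = f 0 0 := by
      refine constant_of_derivWithin_zero (fun t ht => (hf 0 h0 t ht).differentiableWithinAt) ?_
      intro t ht
      have := (hf 0 h0 t (Set.Ico_subset_Icc_self ht)).derivWithin
        (uniqueDiffOn_Icc zero_lt_one t (Set.Ico_subset_Icc_self ht))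
      simpa using this
    simp [hc 1 (by simp), hf0 0 h0]
  · intro x hx
    have hx' : x - x₀ ∈ Metric.ball (0 : E) ρ := by
      rwa [mem_ball_zero_iff, ← dist_eq_norm]
    have h1 := hder _ hx'
    rw [add_sub_cancel] at h1
    have h2 : HasFDerivAt (fun x : E => x - x₀) (ContinuousLinearMap.id ℝ E) x :=
      (hasFDerivAt_id x).sub_const x₀
    exact h1.comp x h2

/-- Solutions of a linear system with smooth coefficients are smooth. -/
theorem contDiffOn_of_linear_system {A : E → E →L[ℝ] W →L[ℝ] W} {U : Set E} (hU : IsOpen U)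
    (hA : ContDiffOn ℝ ∞ A U) {F : E → W}
    (hF : ∀ x ∈ U, HasFDerivAt F ((A x).flip (F x)) x) : ContDiffOn ℝ ∞ F U := by
  have hn : ∀ n : ℕ, ContDiffOn ℝ n F U := by
    intro n
    induction n with
    | zero =>
      exact contDiffOn_zero.2 fun x hx => (hF x hx).continuousAt.continuousWithinAt
    | succ n ih =>
      rw [Nat.cast_succ, contDiffOn_succ_iff_fderiv_of_isOpen hU]
      refine ⟨fun x hx => (hF x hx).differentiableAt.differentiableWithinAt, by simp, ?_⟩
      -- Bootstrapping: the equation expresses the derivative of `F` through `F` itself, so each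
      -- order of smoothness yields the next.
      refine ContDiffOn.congr (f := fun x => (A x).flip (F x)) ?_ fun x hx => (hF x hx).fderiv
      have hA' : ContDiffOn ℝ n A U := hA.of_le (by exact_mod_cast le_top)
      have h1 : ContDiffOn ℝ n (fun x => (A x).flip) U :=
        (ContinuousLinearMap.flipₗᵢ ℝ E W W).toContinuousLinearEquiv.contDiff.comp_contDiffOn hA'
      exact h1.clm_apply ih
  exact contDiffOn_infty.2 hn

end Frobenius

/-! ### Linear systems in the plane with matrix coefficients. -/

section MatrixSystem

set_option maxSynthPendingDepth 3

variable {ι V : Type*} [Fintype ι] [DecidableEq ι] [NormedAddCommGroup V] [NormedSpace ℝ V]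

/-- The action of a real matrix on families of vectors. -/
def matrixAction (V : Type*) [NormedAddCommGroup V] [NormedSpace ℝ V] :
    Matrix ι ι ℝ →ₗ[ℝ] ((ι → V) →L[ℝ] (ι → V)) where
  toFun M := ∑ a, ∑ b, M a b •
    (ContinuousLinearMap.single ℝ (fun _ : ι => V) a ∘L ContinuousLinearMap.proj b)
  map_add' M N := by simp [add_smul, Finset.sum_add_distrib]
  map_smul' c M := by simp [Finset.smul_sum, smul_smul]

theorem matrixAction_apply (M : Matrix ι ι ℝ) (F : ι → V) (a : ι) :
    matrixAction V M F a = ∑ b, M a b • F b := by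
  simp only [matrixAction, LinearMap.coe_mk, AddHom.coe_mk, sum_apply, Finset.sum_apply,
    smul_apply, Pi.smul_apply, ContinuousLinearMap.comp_apply, ContinuousLinearMap.proj_apply,
    ContinuousLinearMap.single_apply]
  rw [Finset.sum_eq_single a]
  · simp
  · intro c _ hc
    simp [Pi.single_eq_of_ne hc.symm]
  · simp

theorem matrixAction_mul (M N : Matrix ι ι ℝ) :
    matrixAction V (M * N) = matrixAction V M ∘L matrixAction V N := by
  ext F a
  simp only [matrixAction_apply, ContinuousLinearMap.comp_apply, Matrix.mul_apply, Finset.sum_smul,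
    Finset.smul_sum, smul_smul]
  exact Finset.sum_comm

/-- The coefficient operator of the system `∂F/∂uⁱ = Aᵢ F`. -/
def systemOperator (V : Type*) [NormedAddCommGroup V] [NormedSpace ℝ V]
    (A : Fin 2 → Plane → Matrix ι ι ℝ) (u : Plane) :
    Plane →L[ℝ] (ι → V) →L[ℝ] (ι → V) :=
  ∑ i, ∑ a, ∑ b, A i u a b • (EuclideanSpace.proj i : Plane →L[ℝ] ℝ).smulRight
    (ContinuousLinearMap.single ℝ (fun _ : ι => V) a ∘L ContinuousLinearMap.proj b)

theorem systemOperator_apply (A : Fin 2 → Plane → Matrix ι ι ℝ) (u v : Plane) :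
    systemOperator V A u v = ∑ i, v i • matrixAction V (A i u) := by
  simp [systemOperator, matrixAction, Finset.smul_sum, smul_smul, mul_comm, sum_apply]

theorem fderiv_eq_sum_pd {G : Type*} [NormedAddCommGroup G] [NormedSpace ℝ G] (f : Plane → G)
    (u v : Plane) : fderiv ℝ f u v = ∑ j, v j • pd j f u := by
  have hv : v = ∑ j, v j • EuclideanSpace.single j (1 : ℝ) := by
    ext k
    fin_cases k <;> simp [Fin.sum_univ_two]
  conv_lhs => rw [hv]
  simp [pd]

theorem fderiv_systemOperator {A : Fin 2 → Plane → Matrix ι ι ℝ} {u : Plane}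
    (hA : ∀ i a b, DifferentiableAt ℝ (fun x => A i x a b) u) (h v : Plane) :
    fderiv ℝ (systemOperator V A) u h v =
      ∑ i, ∑ j, (v i * h j) • matrixAction V (Matrix.of fun a b => pd j (fun x => A i x a b) u) := by
  have hd : HasFDerivAt (systemOperator V A) (∑ i, ∑ a, ∑ b,
      (fderiv ℝ (fun x => A i x a b) u).smulRight ((EuclideanSpace.proj i : Plane →L[ℝ] ℝ).smulRight
      (ContinuousLinearMap.single ℝ (fun _ : ι => V) a ∘L ContinuousLinearMap.proj b))) u := by
    unfold systemOperator
    refine HasFDerivAt.fun_sum fun i _ => HasFDerivAt.fun_sum fun a _ => HasFDerivAt.fun_sum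
      fun b _ => ?_
    exact (hA i a b).hasFDerivAt.smul_const _
  rw [hd.fderiv]
  ext F c
  simp [matrixAction, fderiv_eq_sum_pd, sum_apply, Finset.smul_sum, smul_smul, mul_comm]
  congr 1 <;>
  · rw [← Finset.sum_add_distrib]
    refine Finset.sum_congr rfl fun a _ => ?_
    rw [← Finset.sum_add_distrib]
    refine Finset.sum_congr rfl fun b _ => ?_
    module

/-- **Frobenius theorem** for a system `∂F/∂uⁱ = Aᵢ F` in the plane with matrix coefficients. -/
theorem exists_solution_matrix_system [CompleteSpace V] {A : Fin 2 → Plane → Matrix ι ι ℝ}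
    {U : Set Plane} (hU : IsOpen U) {p₀ : Plane} (hp₀ : p₀ ∈ U)
    (hA : ∀ i a b, ContDiffOn ℝ ∞ (fun x => A i x a b) U)
    (hint : ∀ u ∈ U, ∀ a b, pd 1 (fun x => A 0 x a b) u + (A 0 u * A 1 u) a b =
      pd 0 (fun x => A 1 x a b) u + (A 1 u * A 0 u) a b) (F₀ : ι → V) :
    ∃ ρ > 0, Metric.ball p₀ ρ ⊆ U ∧ ∃ F : Plane → ι → V, F p₀ = F₀ ∧
      ContDiffOn ℝ ∞ F (Metric.ball p₀ ρ) ∧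
      ∀ u ∈ Metric.ball p₀ ρ, ∀ i, pd i F u = fun a => ∑ b, A i u a b • F u b := by
  have hsm : ContDiffOn ℝ ∞ (systemOperator V A) U := by
    unfold systemOperator
    refine ContDiffOn.sum fun i _ => ContDiffOn.sum fun a _ => ContDiffOn.sum fun b _ => ?_
    exact (hA i a b).smul contDiffOn_const
  have hI : ∀ x ∈ U, ∀ u v : Plane,
      fderiv ℝ (systemOperator V A) x u v + systemOperator V A x v ∘L systemOperator V A x u =
      fderiv ℝ (systemOperator V A) x v u + systemOperator V A x u ∘L systemOperator V A x v := by
    intro x hx u v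
    have hd : ∀ i a b, DifferentiableAt ℝ (fun x => A i x a b) x := fun i a b =>
      ((hA i a b).contDiffAt (hU.mem_nhds hx)).differentiableAt (by simp)
    have hm : (Matrix.of fun a b => pd 1 (fun x => A 0 x a b) x) + A 0 x * A 1 x =
        (Matrix.of fun a b => pd 0 (fun x => A 1 x a b) x) + A 1 x * A 0 x := by
      ext a b
      simpa using hint x hx a b
    have hm' := congrArg (matrixAction V) hm
    rw [map_add, map_add, matrixAction_mul, matrixAction_mul] at hm'
    rw [fderiv_systemOperator hd, fderiv_systemOperator hd]
    simp only [systemOperator_apply, Fin.sum_univ_two, ContinuousLinearMap.add_comp,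
      ContinuousLinearMap.comp_add, ContinuousLinearMap.smul_comp, ContinuousLinearMap.comp_smul]
    rw [← sub_eq_zero] at hm' ⊢
    -- The curvature is alternating in `u` and `v`, so in the plane it is the coordinate curvature
    -- times this determinant.
    have := congrArg (fun X => (v 0 * u 1 - v 1 * u 0) • X) hm'
    simp only [smul_zero] at this
    rw [← this]
    module
  obtain ⟨ρ, hρ, hsub, F, hF0, hF⟩ := exists_solution_of_integrable hU hp₀
    (contDiffOn_infty.1 hsm 2) hI F₀
  refine ⟨ρ, hρ, hsub, F, hF0,
    contDiffOn_of_linear_system Metric.isOpen_ball (hsm.mono hsub) hF, fun u hu i => ?_⟩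
  rw [pd, (hF u hu).fderiv]
  funext a
  simp only [ContinuousLinearMap.flip_apply, systemOperator_apply]
  rw [Finset.sum_eq_single i]
  · simp [matrixAction_apply]
  · intro j _ hj
    simp [hj]
  · simp

end MatrixSystem

/-! ### Calculus of partial derivatives. -/

section PartialDerivatives

variable {F : Type*} [NormedAddCommGroup F] [NormedSpace ℝ F] {u : Plane}

theorem pd_congr {f g : Plane → F} {U : Set Plane} (hU : IsOpen U) (hu : u ∈ U)
    (h : ∀ v ∈ U, f v = g v) (i : Fin 2) : pd i f u = pd i g u := by
  have : f =ᶠ[nhds u] g := Filter.eventuallyEq_of_mem (hU.mem_nhds hu) h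
  rw [pd, pd, this.fderiv_eq]

theorem pd_const (c : F) (i : Fin 2) : pd i (fun _ => c) u = 0 := by
  simp [pd]

theorem pd_neg (f : Plane → F) (i : Fin 2) : pd i (fun v => -f v) u = -pd i f u := by
  simp [pd, fderiv_fun_neg]

theorem pd_add {f g : Plane → F} (hf : DifferentiableAt ℝ f u) (hg : DifferentiableAt ℝ g u)
    (i : Fin 2) : pd i (fun v => f v + g v) u = pd i f u + pd i g u := by
  simp [pd, fderiv_fun_add hf hg]

theorem pd_sub {f g : Plane → F} (hf : DifferentiableAt ℝ f u) (hg : DifferentiableAt ℝ g u)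
    (i : Fin 2) : pd i (fun v => f v - g v) u = pd i f u - pd i g u := by
  simp [pd, fderiv_fun_sub hf hg]

theorem pd_smul {c : Plane → ℝ} {f : Plane → F} (hc : DifferentiableAt ℝ c u)
    (hf : DifferentiableAt ℝ f u) (i : Fin 2) :
    pd i (fun v => c v • f v) u = pd i c u • f u + c u • pd i f u := by
  simp [pd, fderiv_fun_smul hc hf, add_comm]

theorem pd_mul {c d : Plane → ℝ} (hc : DifferentiableAt ℝ c u) (hd : DifferentiableAt ℝ d u)
    (i : Fin 2) : pd i (fun v => c v * d v) u = pd i c u * d u + c u * pd i d u :=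
  pd_smul hc hd i

theorem pd_inv {c : Plane → ℝ} (hc : DifferentiableAt ℝ c u) (h0 : c u ≠ 0) (i : Fin 2) :
    pd i (fun v => (c v)⁻¹) u = -(pd i c u / c u ^ 2) := by
  have := ((hasDerivAt_inv h0).comp_hasFDerivAt u hc.hasFDerivAt).fderiv
  have e : (fun v => (c v)⁻¹) = (fun y : ℝ => y⁻¹) ∘ c := rfl
  rw [pd, e, this]
  simp [pd]
  ring

theorem pd_div {c d : Plane → ℝ} (hc : DifferentiableAt ℝ c u) (hd : DifferentiableAt ℝ d u)
    (h0 : d u ≠ 0) (i : Fin 2) :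
    pd i (fun v => c v / d v) u = pd i c u / d u - c u * pd i d u / d u ^ 2 := by
  simp only [div_eq_mul_inv]
  rw [pd_mul (d := fun v => (d v)⁻¹) hc (hd.inv h0), pd_inv hd h0]
  ring

theorem pd_log {c : Plane → ℝ} (hc : DifferentiableAt ℝ c u) (h0 : c u ≠ 0) (i : Fin 2) :
    pd i (fun v => Real.log (c v)) u = pd i c u / c u := by
  simp [pd, (hc.hasFDerivAt.log h0).fderiv]
  ring

theorem contDiffOn_pd {f : Plane → F} {U : Set Plane} (hU : IsOpen U) (hf : ContDiffOn ℝ ∞ f U)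
    (i : Fin 2) : ContDiffOn ℝ ∞ (pd i f) U :=
  (hf.fderiv_of_isOpen hU (m := ∞) (by simp)).clm_apply contDiffOn_const

theorem pd_comm {f : Plane → F} {U : Set Plane} (hU : IsOpen U) (hf : ContDiffOn ℝ ∞ f U)
    (hu : u ∈ U) (i j : Fin 2) : pd i (pd j f) u = pd j (pd i f) u := by
  have hat : ContDiffAt ℝ 2 f u :=
    contDiffAt_infty.1 (hf.contDiffAt (hU.mem_nhds hu)) 2
  have hs : IsSymmSndFDerivAt ℝ f u := hat.isSymmSndFDerivAt (by simp)
  have hd : DifferentiableAt ℝ (fderiv ℝ f) u :=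
    (hat.fderiv_right (m := 1) (by norm_num)).differentiableAt (by norm_num)
  have key : ∀ k l : Fin 2, pd k (pd l f) u =
      fderiv ℝ (fderiv ℝ f) u (EuclideanSpace.single k 1) (EuclideanSpace.single l 1) := by
    intro k l
    have : HasFDerivAt (pd l f) ((fderiv ℝ (fderiv ℝ f) u).flip (EuclideanSpace.single l 1)) u := by
      have := hd.hasFDerivAt.clm_apply (hasFDerivAt_const (EuclideanSpace.single l (1 : ℝ)) u)
      rw [ContinuousLinearMap.comp_zero, zero_add] at this
      exact this
    rw [pd, this.fderiv]
    rfl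
  rw [key, key, hs]

theorem differentiableAt_of_contDiffOn {f : Plane → F} {U : Set Plane} (hU : IsOpen U)
    (hf : ContDiffOn ℝ ∞ f U) (hu : u ∈ U) : DifferentiableAt ℝ f u :=
  (hf.contDiffAt (hU.mem_nhds hu)).differentiableAt (by simp)

end PartialDerivatives

/-! ### The frame connection and its flatness. -/

section Connection

/-- Half the logarithmic derivative of `m`. -/
def halfLogDeriv (m : Plane → ℝ) (i : Fin 2) (u : Plane) : ℝ := pd i m u / (2 * m u)

theorem christoffel_eq (m : Plane → ℝ) (k i j : Fin 2) (u : Plane) :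
    christoffel m k i j u = (if j = k then halfLogDeriv m i u else 0)
      + (if i = k then halfLogDeriv m j u else 0) - (if i = j then halfLogDeriv m k u else 0) := by
  simp only [christoffel, halfLogDeriv]
  split_ifs <;> ring

/-- The coefficient matrices of the frame system for the rows `Y, Y*, ξ, ξ_{u¹}, ξ_{u²}`. -/
def connection (Ω : Plane → Matrix (Fin 2) (Fin 2) ℝ) (m : Plane → ℝ) (w : Plane → Fin 2 → ℝ)
    (Ωs : Plane → Matrix (Fin 2) (Fin 2) ℝ) (i : Fin 2) (u : Plane) : Matrix (Fin 5) (Fin 5) ℝ :=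
  !![-w u i, 0, 0, -(Ω u i 0 / m u), -(Ω u i 1 / m u);
     0, w u i, 0, -(Ωs u 0 i / m u), -(Ωs u 1 i / m u);
     0, 0, 0, if i = 0 then 1 else 0, if i = 1 then 1 else 0;
     -Ωs u 0 i, -Ω u 0 i, if i = 0 then -m u else 0, christoffel m 0 0 i u, christoffel m 1 0 i u;
     -Ωs u 1 i, -Ω u 1 i, if i = 1 then -m u else 0, christoffel m 0 1 i u, christoffel m 1 1 i u]

variable {D : Set Plane} {Ω : Plane → Matrix (Fin 2) (Fin 2) ℝ} {m E : Plane → ℝ}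
  {w : Plane → Fin 2 → ℝ} {Ωs : Plane → Matrix (Fin 2) (Fin 2) ℝ}

theorem contDiffOn_halfLogDeriv (hDo : IsOpen D) (hm : ContDiffOn ℝ ∞ m D)
    (hpos : ∀ u ∈ D, 0 < m u) (i : Fin 2) : ContDiffOn ℝ ∞ (halfLogDeriv m i) D :=
  (contDiffOn_pd hDo hm i).div (contDiffOn_const.mul hm) fun u hu => by
    have := hpos u hu; positivity

theorem contDiffOn_connection (hDo : IsOpen D) (h : IsData D Ω m E w Ωs) (i : Fin 2)
    (a b : Fin 5) : ContDiffOn ℝ ∞ (fun u => connection Ω m w Ωs i u a b) D := by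
  have hs := contDiffOn_halfLogDeriv hDo h.smooth_m h.pos_m
  have hm0 : ∀ u ∈ D, m u ≠ 0 := fun u hu => (h.pos_m u hu).ne'
  have hC : ∀ k i j, ContDiffOn ℝ ∞ (christoffel m k i j) D := by
    intro k i j
    simp only [funext (christoffel_eq m k i j)]
    refine ((?_ : ContDiffOn ℝ ∞ _ D).add ?_).sub ?_ <;> split_ifs <;>
      first | exact hs _ | exact contDiffOn_const
  have hΩ : ∀ k l, ContDiffOn ℝ ∞ (fun u => -(Ω u k l / m u)) D :=
    fun k l => ((h.smooth_Ω k l).div h.smooth_m hm0).neg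
  have hΩs : ∀ k l, ContDiffOn ℝ ∞ (fun u => -(Ωs u k l / m u)) D :=
    fun k l => ((h.smooth_Ωs k l).div h.smooth_m hm0).neg
  have hΩ' : ∀ k l, ContDiffOn ℝ ∞ (fun u => -Ω u k l) D := fun k l => (h.smooth_Ω k l).neg
  have hΩs' : ∀ k l, ContDiffOn ℝ ∞ (fun u => -Ωs u k l) D := fun k l => (h.smooth_Ωs k l).neg
  have hif : ∀ (c : Prop) [Decidable c], ContDiffOn ℝ ∞ (fun u => if c then -m u else 0) D := by
    intro c _
    split_ifs
    · exact h.smooth_m.neg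
    · exact contDiffOn_const
  fin_cases a <;> fin_cases b <;> simp only [connection] <;>
    first
    | exact contDiffOn_const | exact hC _ _ _ | exact hΩ _ _ | exact hΩs _ _ | exact hΩ' _ _
    | exact hΩs' _ _ | exact h.smooth_w i | exact (h.smooth_w i).neg | exact hif _

/-- The integrability equations written with ordinary partial derivatives. -/
structure FlatIntegrability (Ω : Plane → Matrix (Fin 2) (Fin 2) ℝ) (m : Plane → ℝ)
    (w : Plane → Fin 2 → ℝ) (Ωs : Plane → Matrix (Fin 2) (Fin 2) ℝ) (u : Plane) : Prop where
  codazzi₁ : pd 1 (fun v => Ω v 0 0) u - pd 0 (fun v => Ω v 0 1) u =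
    w u 0 * Ω u 0 1 - w u 1 * Ω u 0 0
  codazzi₂ : pd 1 (fun v => Ω v 0 1) u + pd 0 (fun v => Ω v 0 0) u =
    -(w u 0 * Ω u 0 0) - w u 1 * Ω u 0 1
  codazziStar₁ : pd 1 (fun v => Ωs v 0 0) u - pd 0 (fun v => Ωs v 0 1) u =
    -(w u 0 * Ωs u 0 1) + w u 1 * Ωs u 0 0 + (Ωs u 0 0 + Ωs u 1 1) * halfLogDeriv m 1 u
  codazziStar₂ : pd 1 (fun v => Ωs v 0 1) u - pd 0 (fun v => Ωs v 1 1) u =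
    -(w u 0 * Ωs u 1 1) + w u 1 * Ωs u 0 1 - (Ωs u 0 0 + Ωs u 1 1) * halfLogDeriv m 0 u
  codazziMixed : m u * (pd 1 (fun v => w v 0) u - pd 0 (fun v => w v 1) u) =
    2 * Ω u 0 0 * Ωs u 0 1 - (Ωs u 0 0 - Ωs u 1 1) * Ω u 0 1
  gauss : -(m u * (pd 0 (halfLogDeriv m 0) u + pd 1 (halfLogDeriv m 1) u)) - m u ^ 2 =
    Ω u 0 0 * Ωs u 0 0 + 2 * (Ω u 0 1 * Ωs u 0 1) - Ω u 0 0 * Ωs u 1 1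
  closed : pd 1 (halfLogDeriv m 0) u = pd 0 (halfLogDeriv m 1) u

theorem IsData.Ω_one_zero (h : IsData D Ω m E w Ωs) {u : Plane} (hu : u ∈ D) :
    Ω u 1 0 = Ω u 0 1 := (h.symm_Ω u hu).apply 0 1

theorem IsData.Ωs_one_zero (h : IsData D Ω m E w Ωs) {u : Plane} (hu : u ∈ D) :
    Ωs u 1 0 = Ωs u 0 1 := (h.symm_Ωs u hu).apply 0 1

theorem IsData.Ω_one_one (h : IsData D Ω m E w Ωs) {u : Plane} (hu : u ∈ D) :
    Ω u 1 1 = -Ω u 0 0 := by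
  have := h.trace_Ω u hu
  rw [Matrix.trace_fin_two] at this
  linarith

theorem IsData.sq_add_sq (h : IsData D Ω m E w Ωs) {u : Plane} (hu : u ∈ D) :
    Ω u 0 0 ^ 2 + Ω u 0 1 ^ 2 = m u * E u := by
  have := h.m_eq u hu
  have hE := (h.pos_E u hu).ne'
  rw [Matrix.det_fin_two, h.Ω_one_zero hu, h.Ω_one_one hu] at this
  field_simp at this
  linarith

theorem IsData.contDiffOn_E (h : IsData D Ω m E w Ωs) : ContDiffOn ℝ ∞ E D := by
  have : ContDiffOn ℝ ∞ (fun u => (Ω u 0 0 ^ 2 + Ω u 0 1 ^ 2) / m u) D :=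
    (((h.smooth_Ω 0 0).pow 2).add ((h.smooth_Ω 0 1).pow 2)).div h.smooth_m
      fun u hu => (h.pos_m u hu).ne'
  refine this.congr fun u hu => ?_
  have := (h.pos_m u hu).ne'
  rw [h.sq_add_sq hu]
  field_simp

/-- The metric `E |du|²` drops out. Its Christoffel symbols enter an antisymmetrized derivative only
through the trace of the tensor, so they vanish for `Ω`. For `Ωs` they leave the trace times half
the logarithmic derivative of `E`; since `|Ω|² = 2m / E`, the last terms of the starred equations
replace this by the same expression with `m`. -/
theorem IsData.flatIntegrability (hDo : IsOpen D) (h : IsData D Ω m E w Ωs) {u : Plane}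
    (hu : u ∈ D) (hint : IntegrabilityConditions Ω m E w Ωs u) : FlatIntegrability Ω m w Ωs u := by
  have hm : 0 < m u := h.pos_m u hu
  have hE : 0 < E u := h.pos_E u hu
  have hmd := differentiableAt_of_contDiffOn hDo h.smooth_m hu
  have hEd := differentiableAt_of_contDiffOn hDo h.contDiffOn_E hu
  have s10 : Ω u 1 0 = Ω u 0 1 := h.Ω_one_zero hu
  have s11 : Ω u 1 1 = -Ω u 0 0 := h.Ω_one_one hu
  have t10 : Ωs u 1 0 = Ωs u 0 1 := h.Ωs_one_zero hu
  have d11 : ∀ i, pd i (fun v => Ω v 1 1) u = -pd i (fun v => Ω v 0 0) u := fun i => by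
    rw [← pd_neg]; exact pd_congr hDo hu (fun v hv => h.Ω_one_one hv) i
  have hN : ∀ v ∈ D, normSq E Ω v = 2 * m v / E v := fun v hv => by
    have hE' := (h.pos_E v hv).ne'
    have := h.sq_add_sq hv
    simp only [normSq, Fin.sum_univ_two, h.Ω_one_zero hv, h.Ω_one_one hv]
    field_simp
    linarith
  have hNd : ∀ i, pd i (normSq E Ω) u / normSq E Ω u =
      2 * (halfLogDeriv m i u - halfLogDeriv E i u) := fun i => by
    rw [pd_congr hDo hu hN, hN u hu, pd_div (hmd.const_mul 2) hEd hE.ne',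
      pd_mul (differentiableAt_const _) hmd, pd_const]
    simp only [halfLogDeriv]
    field_simp
    ring
  have hlog : ∀ i, ∀ v ∈ D, pd i (fun v => Real.log (m v)) v = 2 * halfLogDeriv m i v :=
    fun i v hv => by
      rw [pd_log (differentiableAt_of_contDiffOn hDo h.smooth_m hv) (h.pos_m v hv).ne']
      have := (h.pos_m v hv).ne'
      simp only [halfLogDeriv]
      field_simp
  have hlog2 : ∀ i j, pd j (pd i fun v => Real.log (m v)) u = 2 * pd j (halfLogDeriv m i) u :=
    fun i j => by
      rw [pd_congr hDo hu (hlog i), pd_mul (differentiableAt_const _)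
        (differentiableAt_of_contDiffOn hDo (contDiffOn_halfLogDeriv hDo h.smooth_m h.pos_m i) hu),
        pd_const]
      ring
  have hlogs : ContDiffOn ℝ ∞ (fun v => Real.log (m v)) D :=
    h.smooth_m.log fun v hv => (h.pos_m v hv).ne'
  obtain ⟨c1, c2, c3, c4, c5, c6⟩ := hint
  simp only [covDeriv, christoffel_eq, Fin.sum_univ_two, s10, s11, d11, t10] at c1 c2 c3 c4
  simp at c1 c2 c3 c4
  have n1 := hNd 1
  have n0 := hNd 0
  rw [div_eq_iff (by rw [hN u hu]; positivity)] at n0 n1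
  have hN0 : normSq E Ω u ≠ 0 := by rw [hN u hu]; positivity
  rw [n1] at c3
  rw [n0] at c4
  refine ⟨by linarith, by linarith, ?_, ?_, ?_, ?_, ?_⟩
  · field_simp at c3
    linarith
  · field_simp at c4
    linarith
  · rw [c5, s11]
    field_simp
    ring
  · rw [gaussCurvature, hlog2, hlog2, Matrix.trace_fin_two, Matrix.mul_apply, Matrix.mul_apply,
      Fin.sum_univ_two, Fin.sum_univ_two, s10, s11, t10] at c6
    field_simp at c6
    linarith
  -- Closedness is not among the six equations: it holds because the 1-form is half of `d log m`.
  · have := pd_comm hDo hlogs hu 1 0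
    rw [hlog2, hlog2] at this
    linarith

/-- Each entry of the curvature either vanishes by the symmetries of `Ω` and `Ωs` or is one of the
equations: the entries joining a null vector to the `Z` are the Codazzi equations, the diagonal
entries of the null vectors are the mixed equation, the off-diagonal `Z` entries are Gauss, and the
diagonal `Z` entries are closedness. -/
theorem connection_integrable (hDo : IsOpen D) (h : IsData D Ω m E w Ωs) {u : Plane}
    (hu : u ∈ D) (hf : FlatIntegrability Ω m w Ωs u) (a b : Fin 5) :
    pd 1 (fun x => connection Ω m w Ωs 0 x a b) u
      + (connection Ω m w Ωs 0 u * connection Ω m w Ωs 1 u) a b =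
    pd 0 (fun x => connection Ω m w Ωs 1 x a b) u
      + (connection Ω m w Ωs 1 u * connection Ω m w Ωs 0 u) a b := by
  have hm : m u ≠ 0 := (h.pos_m u hu).ne'
  have hmd := differentiableAt_of_contDiffOn hDo h.smooth_m hu
  have hΩd := fun i j => differentiableAt_of_contDiffOn hDo (h.smooth_Ω i j) hu
  have hΩsd := fun i j => differentiableAt_of_contDiffOn hDo (h.smooth_Ωs i j) hu
  have s10 : Ω u 1 0 = Ω u 0 1 := h.Ω_one_zero hu
  have s11 : Ω u 1 1 = -Ω u 0 0 := h.Ω_one_one hu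
  have t10 : Ωs u 1 0 = Ωs u 0 1 := h.Ωs_one_zero hu
  have d11 : ∀ i, pd i (fun v => Ω v 1 1) u = -pd i (fun v => Ω v 0 0) u := fun i => by
    rw [← pd_neg]; exact pd_congr hDo hu (fun v hv => h.Ω_one_one hv) i
  have d10 : ∀ i, pd i (fun v => Ω v 1 0) u = pd i (fun v => Ω v 0 1) u := fun i =>
    pd_congr hDo hu (fun v hv => h.Ω_one_zero hv) i
  have e10 : ∀ i, pd i (fun v => Ωs v 1 0) u = pd i (fun v => Ωs v 0 1) u := fun i =>
    pd_congr hDo hu (fun v hv => h.Ωs_one_zero hv) i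
  have hdm : ∀ i, pd i m u = 2 * m u * halfLogDeriv m i u := fun i => by
    simp only [halfLogDeriv]
    field_simp
  have hq : ∀ i k l, pd i (fun v => -(Ω v k l / m v)) u =
      -(pd i (fun v => Ω v k l) u / m u - Ω u k l * (2 * halfLogDeriv m i u) / m u) :=
    fun i k l => by
      rw [pd_neg, pd_div (hΩd k l) hmd hm, hdm]
      field_simp
  have hqs : ∀ i k l, pd i (fun v => -(Ωs v k l / m v)) u =
      -(pd i (fun v => Ωs v k l) u / m u - Ωs u k l * (2 * halfLogDeriv m i u) / m u) :=
    fun i k l => by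
      rw [pd_neg, pd_div (hΩsd k l) hmd hm, hdm]
      field_simp
  obtain ⟨c1, c2, c3, c4, c5, c6, c7⟩ := hf
  have hη : ∀ i, (fun x => halfLogDeriv m i x) = halfLogDeriv m i := fun _ => rfl
  fin_cases a <;> fin_cases b <;>
    simp [connection, Matrix.mul_apply, Fin.sum_univ_five, pd_const, pd_neg, hq, hqs, hdm,
      christoffel_eq, s10, s11, t10, d10, d11, e10, hη]
  all_goals
    first
    | ring1
    | linarith
    | (field_simp; linarith)
    | (rw [c7]; field_simp; ring)

end Connection

/-! ### The Lorentz inner product. -/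

section Lorentz

/-- The Lorentz inner product as a continuous bilinear map. -/
def lorentzBilin : Minkowski →L[ℝ] Minkowski →L[ℝ] ℝ :=
  -((ContinuousLinearMap.mul ℝ ℝ).bilinearComp (ContinuousLinearMap.fst ℝ ℝ E4)
    (ContinuousLinearMap.fst ℝ ℝ E4)) +
  (isBoundedBilinearMap_inner (𝕜 := ℝ) (E := E4)).toContinuousLinearMap.bilinearComp
    (ContinuousLinearMap.snd ℝ ℝ E4) (ContinuousLinearMap.snd ℝ ℝ E4)

theorem lorentzBilin_apply (v w : Minkowski) : lorentzBilin v w = lorentz v w := by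
  simp [lorentzBilin, lorentz, IsBoundedBilinearMap.toContinuousLinearMap_apply]

theorem lorentz_comm (v w : Minkowski) : lorentz v w = lorentz w v := by
  simp only [lorentz, real_inner_comm, mul_comm]

theorem lorentz_add_left (v v' w : Minkowski) :
    lorentz (v + v') w = lorentz v w + lorentz v' w := by
  simp only [← lorentzBilin_apply, map_add, add_apply]

theorem lorentz_add_right (v w w' : Minkowski) :
    lorentz v (w + w') = lorentz v w + lorentz v w' := by
  simp only [← lorentzBilin_apply, map_add]

theorem lorentz_sub_left (v v' w : Minkowski) :
    lorentz (v - v') w = lorentz v w - lorentz v' w := by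
  simp only [← lorentzBilin_apply, map_sub, sub_apply]

theorem lorentz_sub_right (v w w' : Minkowski) :
    lorentz v (w - w') = lorentz v w - lorentz v w' := by
  simp only [← lorentzBilin_apply, map_sub]

theorem lorentz_smul_left (c : ℝ) (v w : Minkowski) : lorentz (c • v) w = c * lorentz v w := by
  simp only [← lorentzBilin_apply, map_smul, smul_apply, smul_eq_mul]

theorem lorentz_smul_right (c : ℝ) (v w : Minkowski) : lorentz v (c • w) = c * lorentz v w := by
  simp only [← lorentzBilin_apply, map_smul, smul_eq_mul]

theorem lorentz_neg_left (v w : Minkowski) : lorentz (-v) w = -lorentz v w := by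
  simp only [← lorentzBilin_apply, map_neg, neg_apply]

theorem lorentz_neg_right (v w : Minkowski) : lorentz v (-w) = -lorentz v w := by
  simp only [← lorentzBilin_apply, map_neg]

theorem lorentz_zero_left (w : Minkowski) : lorentz 0 w = 0 := by
  simp only [← lorentzBilin_apply, map_zero, zero_apply]

theorem contDiffOn_lorentz {f g : Plane → Minkowski} {U : Set Plane} (hf : ContDiffOn ℝ ∞ f U)
    (hg : ContDiffOn ℝ ∞ g U) : ContDiffOn ℝ ∞ (fun u => lorentz (f u) (g u)) U := by
  simp only [← lorentzBilin_apply]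
  exact (lorentzBilin.contDiff.comp_contDiffOn hf).clm_apply hg

theorem differentiableAt_lorentz {f g : Plane → Minkowski} {u : Plane}
    (hf : DifferentiableAt ℝ f u) (hg : DifferentiableAt ℝ g u) :
    DifferentiableAt ℝ (fun v => lorentz (f v) (g v)) u := by
  simp only [← lorentzBilin_apply]
  exact (lorentzBilin.differentiableAt.comp u hf).clm_apply hg

theorem pd_lorentz {f g : Plane → Minkowski} {u : Plane} (hf : DifferentiableAt ℝ f u)
    (hg : DifferentiableAt ℝ g u) (i : Fin 2) :
    pd i (fun v => lorentz (f v) (g v)) u = lorentz (pd i f u) (g u) + lorentz (f u) (pd i g u) := by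
  simp only [← lorentzBilin_apply]
  rw [pd, lorentzBilin.fderiv_of_bilinear hf hg]
  simp [pd, add_comm]

/-- Differentiation of a Lorentz product that is constant on an open set. -/
theorem lorentz_pd_of_const {f g : Plane → Minkowski} {U : Set Plane} (hU : IsOpen U)
    (hf : ContDiffOn ℝ ∞ f U) (hg : ContDiffOn ℝ ∞ g U) {c : ℝ}
    (h : ∀ v ∈ U, lorentz (f v) (g v) = c) {u : Plane} (hu : u ∈ U) (i : Fin 2) :
    lorentz (pd i f u) (g u) = -lorentz (f u) (pd i g u) := by
  have := pd_lorentz (differentiableAt_of_contDiffOn hU hf hu)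
    (differentiableAt_of_contDiffOn hU hg hu) i
  rw [pd_congr hU hu h, pd_const] at this
  linarith

end Lorentz

/-! ### Moving frames and the constancy of the transition between two solutions. -/

section Frames

/-- A moving frame of Minkowski space over the parameter plane. -/
structure MovingFrame where
  /-- The first null vector. -/
  Y : Plane → Minkowski
  /-- The second null vector. -/
  Ys : Plane → Minkowski
  /-- The conformal Gauss map. -/
  ξ : Plane → Minkowski
  /-- The derivatives of the conformal Gauss map. -/
  Z : Fin 2 → Plane → Minkowski

/-- The inner products of a moving frame adapted to a surface with Möbius metric `m |du|²`. -/
structure MovingFrame.IsAdapted (f : MovingFrame) (m : Plane → ℝ) (u : Plane) : Prop where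
  Y_Y : lorentz (f.Y u) (f.Y u) = 0
  Ys_Ys : lorentz (f.Ys u) (f.Ys u) = 0
  Y_Ys : lorentz (f.Y u) (f.Ys u) = -1
  Y_ξ : lorentz (f.Y u) (f.ξ u) = 0
  Ys_ξ : lorentz (f.Ys u) (f.ξ u) = 0
  ξ_ξ : lorentz (f.ξ u) (f.ξ u) = 1
  Y_Z : ∀ i, lorentz (f.Y u) (f.Z i u) = 0
  Ys_Z : ∀ i, lorentz (f.Ys u) (f.Z i u) = 0
  ξ_Z : ∀ i, lorentz (f.ξ u) (f.Z i u) = 0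
  Z_Z : ∀ i j, lorentz (f.Z i u) (f.Z j u) = if i = j then m u else 0

/-- A smooth moving frame solving the structure equations over `U`. -/
structure MovingFrame.IsSolution (f : MovingFrame) (U : Set Plane)
    (Ω : Plane → Matrix (Fin 2) (Fin 2) ℝ) (m : Plane → ℝ) (w : Plane → Fin 2 → ℝ)
    (Ωs : Plane → Matrix (Fin 2) (Fin 2) ℝ) : Prop where
  smooth_Y : ContDiffOn ℝ ∞ f.Y U
  smooth_Ys : ContDiffOn ℝ ∞ f.Ys U
  smooth_ξ : ContDiffOn ℝ ∞ f.ξ U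
  smooth_Z : ∀ i, ContDiffOn ℝ ∞ (f.Z i) U
  pd_Y : ∀ u ∈ U, ∀ i, pd i f.Y u =
    -(w u i • f.Y u) - (Ω u i 0 / m u) • f.Z 0 u - (Ω u i 1 / m u) • f.Z 1 u
  pd_Ys : ∀ u ∈ U, ∀ i, pd i f.Ys u =
    w u i • f.Ys u - (Ωs u 0 i / m u) • f.Z 0 u - (Ωs u 1 i / m u) • f.Z 1 u
  pd_ξ : ∀ u ∈ U, ∀ i, pd i f.ξ u = f.Z i u
  pd_Z : ∀ u ∈ U, ∀ i j, pd i (f.Z j) u =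
    christoffel m 0 j i u • f.Z 0 u + christoffel m 1 j i u • f.Z 1 u
      - (if i = j then m u else 0) • f.ξ u - Ωs u j i • f.Y u - Ω u j i • f.Ys u

/-- The value at `v` of the linear map that carries the frame `g u` to the frame `f u`, if `g u` is
adapted. -/
def transition (m : Plane → ℝ) (f g : MovingFrame) (v : Minkowski) (u : Plane) : Minkowski :=
  -(lorentz (g.Ys u) v • f.Y u) - lorentz (g.Y u) v • f.Ys u + lorentz (g.ξ u) v • f.ξ u
    + (lorentz (g.Z 0 u) v / m u) • f.Z 0 u + (lorentz (g.Z 1 u) v / m u) • f.Z 1 u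

variable {U D : Set Plane} {Ω : Plane → Matrix (Fin 2) (Fin 2) ℝ} {m E : Plane → ℝ}
  {w : Plane → Fin 2 → ℝ} {Ωs : Plane → Matrix (Fin 2) (Fin 2) ℝ} {f g : MovingFrame}

theorem pd_combination {F : Type*} [NormedAddCommGroup F] [NormedSpace ℝ F]
    {A₀ A₁ A₂ A₃ A₄ : Plane → F} {c₀ c₁ c₂ c₃ c₄ : Plane → ℝ} {u : Plane}
    (hA₀ : DifferentiableAt ℝ A₀ u) (hA₁ : DifferentiableAt ℝ A₁ u) (hA₂ : DifferentiableAt ℝ A₂ u)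
    (hA₃ : DifferentiableAt ℝ A₃ u) (hA₄ : DifferentiableAt ℝ A₄ u)
    (hc₀ : DifferentiableAt ℝ c₀ u) (hc₁ : DifferentiableAt ℝ c₁ u) (hc₂ : DifferentiableAt ℝ c₂ u)
    (hc₃ : DifferentiableAt ℝ c₃ u) (hc₄ : DifferentiableAt ℝ c₄ u) (i : Fin 2) :
    pd i (fun v => -(c₀ v • A₀ v) - c₁ v • A₁ v + c₂ v • A₂ v + c₃ v • A₃ v + c₄ v • A₄ v) u =
      -(pd i c₀ u • A₀ u + c₀ u • pd i A₀ u) - (pd i c₁ u • A₁ u + c₁ u • pd i A₁ u)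
        + (pd i c₂ u • A₂ u + c₂ u • pd i A₂ u) + (pd i c₃ u • A₃ u + c₃ u • pd i A₃ u)
        + (pd i c₄ u • A₄ u + c₄ u • pd i A₄ u) := by
  rw [pd_add (by fun_prop) (by fun_prop), pd_add (by fun_prop) (by fun_prop),
    pd_add (by fun_prop) (by fun_prop), pd_sub (by fun_prop) (by fun_prop), pd_neg,
    pd_smul hc₀ hA₀, pd_smul hc₁ hA₁, pd_smul hc₂ hA₂, pd_smul hc₃ hA₃, pd_smul hc₄ hA₄]

/-- The coefficients of the structure equations are skew for the model Gram matrix, so the terms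
from differentiating `f` cancel those from differentiating `g`. The derivative of the weight `1 / m`
is absorbed by the Christoffel symbols, which is metric compatibility. No inner products of the
frames are used, so the lemma can serve to prove that a solution is adapted. -/
theorem pd_transition (hU : IsOpen U) (hd : IsData D Ω m E w Ωs) (hUD : U ⊆ D)
    (hf : f.IsSolution U Ω m w Ωs) (hg : g.IsSolution U Ω m w Ωs) (v : Minkowski) {u : Plane}
    (hu : u ∈ U) (i : Fin 2) : pd i (transition m f g v) u = 0 := by
  have hm : m u ≠ 0 := (hd.pos_m u (hUD hu)).ne'
  have hmd := differentiableAt_of_contDiffOn hU (hd.smooth_m.mono hUD) hu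
  have s10 : Ω u 1 0 = Ω u 0 1 := hd.Ω_one_zero (hUD hu)
  have t10 : Ωs u 1 0 = Ωs u 0 1 := hd.Ωs_one_zero (hUD hu)
  have dfY := differentiableAt_of_contDiffOn hU hf.smooth_Y hu
  have dfYs := differentiableAt_of_contDiffOn hU hf.smooth_Ys hu
  have dfξ := differentiableAt_of_contDiffOn hU hf.smooth_ξ hu
  have dfZ := fun j => differentiableAt_of_contDiffOn hU (hf.smooth_Z j) hu
  have dv : DifferentiableAt ℝ (fun _ : Plane => v) u := differentiableAt_const _
  have dgY := differentiableAt_of_contDiffOn hU hg.smooth_Y hu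
  have dgYs := differentiableAt_of_contDiffOn hU hg.smooth_Ys hu
  have dgξ := differentiableAt_of_contDiffOn hU hg.smooth_ξ hu
  have dgZ := fun j => differentiableAt_of_contDiffOn hU (hg.smooth_Z j) hu
  have hl : ∀ {h : Plane → Minkowski}, DifferentiableAt ℝ h u →
      pd i (fun x => lorentz (h x) v) u = lorentz (pd i h u) v := fun {h} hh => by
    rw [pd_lorentz hh dv, pd_const, lorentz_comm (h u), lorentz_zero_left, add_zero]
  have dl : ∀ {h : Plane → Minkowski}, DifferentiableAt ℝ h u →
      DifferentiableAt ℝ (fun x => lorentz (h x) v) u := fun hh => differentiableAt_lorentz hh dv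
  have dq : ∀ j, DifferentiableAt ℝ (fun x => lorentz (g.Z j x) v / m x) u := fun j => by
    have := (dl (dgZ j)).fun_mul (hmd.fun_inv hm)
    simpa only [div_eq_mul_inv] using! this
  have hdm : pd i m u = 2 * m u * halfLogDeriv m i u := by
    simp only [halfLogDeriv]
    field_simp
  unfold transition
  rw [pd_combination dfY dfYs dfξ (dfZ 0) (dfZ 1) (dl dgYs) (dl dgY) (dl dgξ) (dq 0) (dq 1),
    pd_div (dl (dgZ 0)) hmd hm, pd_div (dl (dgZ 1)) hmd hm,
    hl dgYs, hl dgY, hl dgξ, hl (dgZ 0), hl (dgZ 1), hdm, hf.pd_Y u hu, hf.pd_Ys u hu,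
    hf.pd_ξ u hu, hf.pd_Z u hu, hf.pd_Z u hu, hg.pd_Y u hu, hg.pd_Ys u hu,
    hg.pd_ξ u hu, hg.pd_Z u hu, hg.pd_Z u hu]
  simp only [lorentz_add_left, lorentz_sub_left, lorentz_smul_left, lorentz_neg_left]
  fin_cases i <;> simp [christoffel_eq, s10, t10] <;> match_scalars <;> field_simp <;> ring

theorem transition_const (hU : IsOpen U) (hUc : IsPreconnected U) (hd : IsData D Ω m E w Ωs)
    (hUD : U ⊆ D) (hf : f.IsSolution U Ω m w Ωs) (hg : g.IsSolution U Ω m w Ωs) (v : Minkowski)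
    {u u' : Plane} (hu : u ∈ U) (hu' : u' ∈ U) : transition m f g v u = transition m f g v u' := by
  have hm : ∀ u ∈ U, m u ≠ 0 := fun u hu => (hd.pos_m u (hUD hu)).ne'
  have hl : ∀ {h : Plane → Minkowski}, ContDiffOn ℝ ∞ h U →
      ContDiffOn ℝ ∞ (fun x => lorentz (h x) v) U := fun hh => contDiffOn_lorentz hh contDiffOn_const
  have hq : ∀ j, ContDiffOn ℝ ∞ (fun x => lorentz (g.Z j x) v / m x) U := fun j =>
    (hl (hg.smooth_Z j)).div (hd.smooth_m.mono hUD) hm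
  have hs : ContDiffOn ℝ ∞ (transition m f g v) U :=
    (((((hl hg.smooth_Ys).smul hf.smooth_Y).neg.sub ((hl hg.smooth_Y).smul hf.smooth_Ys)).add
      ((hl hg.smooth_ξ).smul hf.smooth_ξ)).add ((hq 0).smul (hf.smooth_Z 0))).add
      ((hq 1).smul (hf.smooth_Z 1))
  refine hU.is_const_of_fderiv_eq_zero hUc (hs.differentiableOn (by simp)) (fun x hx => ?_) hu hu'
  ext1 y
  rw [fderiv_eq_sum_pd]
  simp [pd_transition hU hd hUD hf hg v hx]

theorem comp_eq_id_of_finrank_eq {V W : Type*} [AddCommGroup V] [Module ℝ V] [AddCommGroup W]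
    [Module ℝ W] [FiniteDimensional ℝ V] [FiniteDimensional ℝ W]
    (h : Module.finrank ℝ V = Module.finrank ℝ W) {L : V →ₗ[ℝ] W} {R : W →ₗ[ℝ] V}
    (hRL : ∀ c, R (L c) = c) (v : W) : L (R v) = v := by
  have hinj : Function.Injective L := Function.LeftInverse.injective hRL
  obtain ⟨c, rfl⟩ := (LinearMap.injective_iff_surjective_of_finrank_eq_finrank h).1 hinj v
  rw [hRL]

/-- Linear combinations of the members of a frame. -/
def MovingFrame.combination (f : MovingFrame) (u : Plane) : (Fin 5 → ℝ) →ₗ[ℝ] Minkowski where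
  toFun c := c 0 • f.Y u + c 1 • f.Ys u + c 2 • f.ξ u + c 3 • f.Z 0 u + c 4 • f.Z 1 u
  map_add' c d := by simp only [Pi.add_apply]; module
  map_smul' c d := by simp only [Pi.smul_apply, smul_eq_mul, RingHom.id_apply]; module

/-- The coordinates with respect to an adapted frame. -/
def MovingFrame.coordinates (f : MovingFrame) (m : Plane → ℝ) (u : Plane) :
    Minkowski →ₗ[ℝ] (Fin 5 → ℝ) where
  toFun v := ![-lorentz (f.Ys u) v, -lorentz (f.Y u) v, lorentz (f.ξ u) v,
    lorentz (f.Z 0 u) v / m u, lorentz (f.Z 1 u) v / m u]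
  map_add' v v' := by
    ext a; fin_cases a <;> simp [lorentz_add_right] <;> ring
  map_smul' c v := by
    ext a; fin_cases a <;> simp [lorentz_smul_right] <;> ring

theorem combination_coordinates (f g : MovingFrame) (u : Plane) (v : Minkowski) :
    f.combination u (g.coordinates m u v) = transition m f g v u := by
  simp [MovingFrame.combination, MovingFrame.coordinates, transition]
  abel

theorem finrank_minkowski : Module.finrank ℝ (Fin 5 → ℝ) = Module.finrank ℝ Minkowski := by
  simp

theorem MovingFrame.IsAdapted.coordinates_combination {u : Plane} (hm : m u ≠ 0)
    (hf : f.IsAdapted m u) (c : Fin 5 → ℝ) : f.coordinates m u (f.combination u c) = c := by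
  have h1 : lorentz (f.Ys u) (f.Y u) = -1 := by rw [lorentz_comm, hf.Y_Ys]
  have h2 : lorentz (f.ξ u) (f.Y u) = 0 := by rw [lorentz_comm, hf.Y_ξ]
  have h3 : lorentz (f.ξ u) (f.Ys u) = 0 := by rw [lorentz_comm, hf.Ys_ξ]
  have h4 : ∀ i, lorentz (f.Z i u) (f.Y u) = 0 := fun i => by rw [lorentz_comm, hf.Y_Z]
  have h5 : ∀ i, lorentz (f.Z i u) (f.Ys u) = 0 := fun i => by rw [lorentz_comm, hf.Ys_Z]
  have h6 : ∀ i, lorentz (f.Z i u) (f.ξ u) = 0 := fun i => by rw [lorentz_comm, hf.ξ_Z]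
  ext a
  fin_cases a <;> simp [coordinates, combination, lorentz_add_right, lorentz_smul_right, hf.Y_Y,
    hf.Ys_Ys, hf.Y_Ys, hf.Y_ξ, hf.Ys_ξ, hf.ξ_ξ, hf.Y_Z, hf.Ys_Z, hf.ξ_Z, hf.Z_Z, h1, h2, h3, h4,
    h5, h6, hm]

/-- Every vector is recovered from its products with an adapted frame. -/
theorem MovingFrame.IsAdapted.transition_self {u : Plane} (hm : m u ≠ 0)
    (hf : f.IsAdapted m u) (v : Minkowski) : transition m f f v u = v := by
  rw [← combination_coordinates]
  exact comp_eq_id_of_finrank_eq finrank_minkowski (hf.coordinates_combination hm) v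

/-- The hypothesis makes `coordinates` a right inverse of `combination`. By dimension it is also a
left inverse, and the entries of that identity are the inner products of the frame. -/
theorem isAdapted_of_transition_self {u : Plane} (hm : m u ≠ 0)
    (h : ∀ v, transition m f f v u = v) : f.IsAdapted m u := by
  have key : ∀ c, f.coordinates m u (f.combination u c) = c :=
    comp_eq_id_of_finrank_eq finrank_minkowski.symm
      (fun v => (combination_coordinates f f u v).trans (h v))
  -- Evaluation on the standard basis gives the Gram matrix column by column.
  have c0 := key ![1, 0, 0, 0, 0]
  have c1 := key ![0, 1, 0, 0, 0]
  have c2 := key ![0, 0, 1, 0, 0]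
  have c3 := key ![0, 0, 0, 1, 0]
  have c4 := key ![0, 0, 0, 0, 1]
  simp [MovingFrame.coordinates, MovingFrame.combination, hm] at c0 c1 c2 c3 c4
  rw [div_eq_one_iff_eq hm] at c3 c4
  obtain ⟨a0, a1, a2, a3, a4⟩ := c0
  obtain ⟨b0, b1, b2, b3, b4⟩ := c1
  obtain ⟨d0, d1, d2, d3, d4⟩ := c2
  obtain ⟨e0, e1, e2, e3, e4⟩ := c3
  obtain ⟨k0, k1, k2, k3, k4⟩ := c4
  refine ⟨a1, b0, by linarith, d1, d0, d2, ?_, ?_, ?_, ?_⟩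
  · intro i; fin_cases i <;> assumption
  · intro i; fin_cases i <;> assumption
  · intro i; fin_cases i <;> assumption
  · intro i j; fin_cases i <;> fin_cases j <;> simp <;> assumption

end Frames

/-! ### The sphere as the space of future null directions. -/

section Sphere

/-- A point of the unit sphere `S3`. -/
def spherePole : S3 := ⟨EuclideanSpace.single 0 1, by simp⟩

open Classical in
/-- The point of the sphere represented by a null vector with nonzero time component. -/
def toSphere (v : Minkowski) : S3 :=
  -- The default value is never taken on a null vector with positive time component, by
  -- `norm_eq_one_of_null`.
  if h : ‖v.1⁻¹ • v.2‖ = 1 then ⟨v.1⁻¹ • v.2, by simpa using h⟩ else spherePole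

theorem lorentz_self (v : Minkowski) : lorentz v v = -v.1 ^ 2 + ‖v.2‖ ^ 2 := by
  simp only [lorentz, real_inner_self_eq_norm_sq]
  ring

theorem norm_eq_one_of_null {v : Minkowski} (hv : lorentz v v = 0) (h0 : 0 < v.1) :
    ‖v.1⁻¹ • v.2‖ = 1 := by
  have h1 : ‖v.2‖ = v.1 := by
    rw [lorentz_self] at hv
    exact (pow_left_inj₀ (norm_nonneg _) h0.le two_ne_zero).1 (by linarith)
  rw [norm_smul, norm_inv, Real.norm_of_nonneg h0.le, h1, inv_mul_cancel₀ h0.ne']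

theorem coe_toSphere {v : Minkowski} (hv : lorentz v v = 0) (h0 : 0 < v.1) :
    (toSphere v : E4) = v.1⁻¹ • v.2 := by
  rw [toSphere, dif_pos (norm_eq_one_of_null hv h0)]

theorem nullLift_toSphere {v : Minkowski} (hv : lorentz v v = 0) (h0 : 0 < v.1) :
    nullLift (toSphere v) = v.1⁻¹ • v := by
  ext1
  · simp [nullLift, h0.ne']
  · simp [nullLift, coe_toSphere hv h0]

theorem lorentz_nullLift (p q : S3) : lorentz (nullLift p) (nullLift q) = -1 + ⟪(p : E4), q⟫_ℝ := by
  simp [lorentz, nullLift]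

theorem lorentz_nullLift_self (p : S3) : lorentz (nullLift p) (nullLift p) = 0 := by
  simp [lorentz_nullLift]

variable {U : Set Plane} {x : Plane → S3} {n : Plane → E4} {u : Plane}

theorem contDiffOn_nullLift (hx : ContDiffOn ℝ ∞ (fun u => (x u : E4)) U) :
    ContDiffOn ℝ ∞ (fun u => nullLift (x u)) U :=
  contDiffOn_const.prodMk hx

theorem pd_prodMk {F G : Type*} [NormedAddCommGroup F] [NormedSpace ℝ F] [NormedAddCommGroup G]
    [NormedSpace ℝ G] {f : Plane → F} {g : Plane → G} (hf : DifferentiableAt ℝ f u)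
    (hg : DifferentiableAt ℝ g u) (i : Fin 2) :
    pd i (fun v => (f v, g v)) u = (pd i f u, pd i g u) := by
  simp [pd, (hf.hasFDerivAt.prodMk hg.hasFDerivAt).fderiv]

theorem pd_fst {f : Plane → Minkowski} (hf : DifferentiableAt ℝ f u) (i : Fin 2) :
    pd i (fun v => (f v).1) u = (pd i f u).1 := by
  simp [pd, hf.hasFDerivAt.fst.fderiv]

theorem pd_nullLift (hx : DifferentiableAt ℝ (fun u => (x u : E4)) u) (i : Fin 2) :
    pd i (fun v => nullLift (x v)) u = (0, pd i (fun v => (x v : E4)) u) := by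
  have := pd_prodMk (differentiableAt_const (1 : ℝ)) hx i
  rwa [pd_const] at this

theorem pd_zero_prodMk (hn : DifferentiableAt ℝ n u) (i : Fin 2) :
    pd i (fun v => ((0, n v) : Minkowski)) u = (0, pd i n u) := by
  have := pd_prodMk (differentiableAt_const (0 : ℝ)) hn i
  rwa [pd_const] at this

theorem firstForm_eq (hx : DifferentiableAt ℝ (fun u => (x u : E4)) u) (i j : Fin 2) :
    firstForm x u i j =
      lorentz (pd i (fun v => nullLift (x v)) u) (pd j (fun v => nullLift (x v)) u) := by
  simp [firstForm, pd_nullLift hx, lorentz]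

theorem secondForm_eq (hx : DifferentiableAt ℝ (fun u => (x u : E4)) u)
    (hn : DifferentiableAt ℝ n u) (i j : Fin 2) :
    secondForm x n u i j =
      -lorentz (pd i (fun v => nullLift (x v)) u) (pd j (fun v => ((0, n v) : Minkowski)) u) := by
  simp [secondForm, pd_nullLift hx, pd_zero_prodMk hn, lorentz]

end Sphere

/-! ### Existence: from an adapted solution to a surface. -/

section Existence

variable {U D : Set Plane} {Ω : Plane → Matrix (Fin 2) (Fin 2) ℝ} {m E : Plane → ℝ}
  {w : Plane → Fin 2 → ℝ} {Ωs : Plane → Matrix (Fin 2) (Fin 2) ℝ}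

theorem MovingFrame.IsSolution.mono {f : MovingFrame} {V : Set Plane}
    (hf : f.IsSolution V Ω m w Ωs) (h : U ⊆ V) : f.IsSolution U Ω m w Ωs where
  smooth_Y := hf.smooth_Y.mono h
  smooth_Ys := hf.smooth_Ys.mono h
  smooth_ξ := hf.smooth_ξ.mono h
  smooth_Z i := (hf.smooth_Z i).mono h
  pd_Y u hu := hf.pd_Y u (h hu)
  pd_Ys u hu := hf.pd_Ys u (h hu)
  pd_ξ u hu := hf.pd_ξ u (h hu)
  pd_Z u hu := hf.pd_Z u (h hu)

/-- The rows of a family of five vectors form a moving frame. -/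
def frameOfRows (F : Plane → Fin 5 → Minkowski) : MovingFrame where
  Y u := F u 0
  Ys u := F u 1
  ξ u := F u 2
  Z i u := F u (![3, 4] i)

/-- The initial frame at a point where the Möbius metric is `μ |du|²`. -/
def initialFrame (μ : ℝ) : Fin 5 → Minkowski :=
  -- Two future null vectors with product `-1`, completed orthogonally. The time component 1 of the
  -- first will be the normalization of the scale factor at `p₀`.
  ![(1, EuclideanSpace.single 0 1), (1 / 2, EuclideanSpace.single 0 (-1 / 2)),
    (0, EuclideanSpace.single 1 1), (0, EuclideanSpace.single 2 √μ),
    (0, EuclideanSpace.single 3 √μ)]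

theorem exists_adapted_solution (hDo : IsOpen D) (hd : IsData D Ω m E w Ωs)
    (hint : ∀ u ∈ D, IntegrabilityConditions Ω m E w Ωs u) {p₀ : Plane} (hp₀ : p₀ ∈ D) :
    ∃ ρ > 0, Metric.ball p₀ ρ ⊆ D ∧ ∃ f : MovingFrame,
      f.IsSolution (Metric.ball p₀ ρ) Ω m w Ωs ∧ (∀ u ∈ Metric.ball p₀ ρ, f.IsAdapted m u) ∧
      (f.Y p₀).1 = 1 ∧ (f.Ys p₀).1 = 1 / 2 := by
  obtain ⟨ρ, hρ, hsub, F, hF0, hFs, hF⟩ := exists_solution_matrix_system hDo hp₀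
    (contDiffOn_connection hDo hd)
    (fun u hu => connection_integrable hDo hd hu (hd.flatIntegrability hDo hu (hint u hu)))
    (initialFrame (m p₀))
  have hp : p₀ ∈ Metric.ball p₀ ρ := Metric.mem_ball_self hρ
  have hrow : ∀ a, ContDiffOn ℝ ∞ (fun u => F u a) (Metric.ball p₀ ρ) := contDiffOn_pi.1 hFs
  have hpd : ∀ u ∈ Metric.ball p₀ ρ, ∀ i a,
      pd i (fun v => F v a) u = ∑ b, connection Ω m w Ωs i u a b • F u b := by
    intro u hu i a
    rw [← congrFun (hF u hu i) a, pd, pd]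
    have hdiff := differentiableAt_of_contDiffOn Metric.isOpen_ball hFs hu
    rw [((hasFDerivAt_pi').1 hdiff.hasFDerivAt a).fderiv]
    rfl
  have hsol : (frameOfRows F).IsSolution (Metric.ball p₀ ρ) Ω m w Ωs := by
    refine ⟨hrow 0, hrow 1, hrow 2, fun i => hrow _, fun u hu i => ?_, fun u hu i => ?_,
      fun u hu i => ?_, fun u hu i j => ?_⟩
    · refine (hpd u hu i 0).trans ?_
      simp [connection, Fin.sum_univ_five, frameOfRows]
      module
    · refine (hpd u hu i 1).trans ?_
      simp [connection, Fin.sum_univ_five, frameOfRows]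
      module
    · refine (hpd u hu i 2).trans ?_
      fin_cases i <;> simp [connection, Fin.sum_univ_five, frameOfRows]
    · refine (hpd u hu i _).trans ?_
      fin_cases i <;> fin_cases j <;> simp [connection, Fin.sum_univ_five, frameOfRows] <;> module
  refine ⟨ρ, hρ, hsub, frameOfRows F, hsol, fun u hu => ?_, by simp [frameOfRows, hF0, initialFrame],
    by simp [frameOfRows, hF0, initialFrame]⟩
  have hm := hd.pos_m p₀ hp₀
  have hsq : √(m p₀) * √(m p₀) = m p₀ := Real.mul_self_sqrt hm.le
  have hini : (frameOfRows F).IsAdapted m p₀ := by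
    constructor
    case Y_Z => intro i; fin_cases i <;> simp [lorentz, frameOfRows, hF0, initialFrame, PiLp.inner_apply]
    case Ys_Z => intro i; fin_cases i <;> simp [lorentz, frameOfRows, hF0, initialFrame, PiLp.inner_apply]
    case ξ_Z => intro i; fin_cases i <;> simp [lorentz, frameOfRows, hF0, initialFrame, PiLp.inner_apply]
    case Z_Z =>
      intro i j
      fin_cases i <;> fin_cases j <;> simp [lorentz, frameOfRows, hF0, initialFrame, PiLp.inner_apply, hsq,
        hm.le]
    all_goals simp [lorentz, frameOfRows, hF0, initialFrame, PiLp.inner_apply]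
    all_goals norm_num
  -- The transition of the solution to itself is constant, and it is the identity at `p₀` because
  -- the initial frame is adapted.
  refine isAdapted_of_transition_self (hd.pos_m u (hsub hu)).ne' fun v => ?_
  rw [transition_const Metric.isOpen_ball (convex_ball p₀ ρ).isPreconnected hd hsub hsol hsol v hu
    hp]
  exact hini.transition_self hm.ne' v

/-- A traceless symmetric 2-by-2 matrix squares to minus its determinant times the identity; here
this scalar is `m * E`. -/
theorem IsData.inv_smul_Ω (h : IsData D Ω m E w Ωs) {u : Plane} (hu : u ∈ D) {c : ℝ} (hc : c ≠ 0) :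
    (c⁻¹ • Ω u)⁻¹ = (c / (m u * E u)) • Ω u := by
  have hm := (h.pos_m u hu).ne'
  have hE := (h.pos_E u hu).ne'
  have hsq := h.sq_add_sq hu
  refine Matrix.inv_eq_right_inv ?_
  ext i j
  fin_cases i <;> fin_cases j <;>
    simp [Matrix.mul_apply, Fin.sum_univ_two, h.Ω_one_zero hu, h.Ω_one_one hu] <;>
    field_simp <;> linarith

/-- An adapted solution of the structure equations whose null vectors are future directed
realizes the data. -/
theorem realizes_of_adapted_solution (hUo : IsOpen U) (hd : IsData D Ω m E w Ωs) (hUD : U ⊆ D)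
    {f : MovingFrame} (hf : f.IsSolution U Ω m w Ωs) (ha : ∀ u ∈ U, f.IsAdapted m u)
    (hY : ∀ u ∈ U, 0 < (f.Y u).1) (hYs : ∀ u ∈ U, 0 < (f.Ys u).1) {p₀ : Plane}
    (h0 : (f.Y p₀).1 = 1) :
    Realizes U p₀ Ω m w Ωs (fun u => toSphere (f.Y u))
      (fun u => (f.ξ u).2 - (f.ξ u).1 • (toSphere (f.Y u) : E4)) fun u => (f.Y u).1 := by
  set lam : Plane → ℝ := fun u => (f.Y u).1 with hlam
  set x : Plane → S3 := fun u => toSphere (f.Y u) with hx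
  set n : Plane → E4 := fun u => (f.ξ u).2 - (f.ξ u).1 • (x u : E4) with hn
  set xs : Plane → S3 := fun u => toSphere (f.Ys u) with hxs
  have slam : ContDiffOn ℝ ∞ lam U := hf.smooth_Y.fst
  have lam0 : ∀ u ∈ U, lam u ≠ 0 := fun u hu => (hY u hu).ne'
  have sx : ContDiffOn ℝ ∞ (fun u => (x u : E4)) U :=
    ((slam.inv lam0).smul hf.smooth_Y.snd).congr fun u hu => coe_toSphere (ha u hu).Y_Y (hY u hu)
  have sxs : ContDiffOn ℝ ∞ (fun u => (xs u : E4)) U :=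
    ((hf.smooth_Ys.fst.inv fun u hu => (hYs u hu).ne').smul hf.smooth_Ys.snd).congr
      fun u hu => coe_toSphere (ha u hu).Ys_Ys (hYs u hu)
  have sn : ContDiffOn ℝ ∞ n U := hf.smooth_ξ.snd.sub (hf.smooth_ξ.fst.smul sx)
  have hy : ∀ u ∈ U, nullLift (x u) = (lam u)⁻¹ • f.Y u := fun u hu =>
    nullLift_toSphere (ha u hu).Y_Y (hY u hu)
  have hN : ∀ u ∈ U, ((0, n u) : Minkowski) = f.ξ u - (f.ξ u).1 • nullLift (x u) := fun u hu => by
    ext1 <;> simp [hn, nullLift]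
  have dx : ∀ u ∈ U, DifferentiableAt ℝ (fun u => (x u : E4)) u := fun u hu =>
    differentiableAt_of_contDiffOn hUo sx hu
  have dn : ∀ u ∈ U, DifferentiableAt ℝ n u := fun u hu => differentiableAt_of_contDiffOn hUo sn hu
  have dlam : ∀ u ∈ U, DifferentiableAt ℝ lam u := fun u hu =>
    differentiableAt_of_contDiffOn hUo slam hu
  have dY : ∀ u ∈ U, DifferentiableAt ℝ f.Y u := fun u hu =>
    differentiableAt_of_contDiffOn hUo hf.smooth_Y hu
  have dξ : ∀ u ∈ U, DifferentiableAt ℝ f.ξ u := fun u hu =>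
    differentiableAt_of_contDiffOn hUo hf.smooth_ξ hu
  have dNy : ∀ u ∈ U, DifferentiableAt ℝ (fun v => nullLift (x v)) u := fun u hu =>
    differentiableAt_of_contDiffOn hUo (contDiffOn_nullLift sx) hu
  -- The coefficient `α` need not be known: `Y` is null and orthogonal to `ξ` and the `Z`, so it
  -- contributes to none of the products below.
  have hYi : ∀ u ∈ U, ∀ i, ∃ α : ℝ, pd i (fun v => nullLift (x v)) u = α • f.Y u
      - (Ω u i 0 / (lam u * m u)) • f.Z 0 u - (Ω u i 1 / (lam u * m u)) • f.Z 1 u := by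
    intro u hu i
    have := hd.pos_m u (hUD hu)
    have := lam0 u hu
    refine ⟨pd i (fun v => (lam v)⁻¹) u - w u i / lam u, ?_⟩
    rw [pd_congr hUo hu hy, pd_smul ((dlam u hu).fun_inv (lam0 u hu)) (dY u hu), hf.pd_Y u hu]
    match_scalars <;> field_simp
    ring
  choose! α hα using hYi
  have hξi : ∀ u ∈ U, ∀ i, pd i f.ξ u = f.Z i u := hf.pd_ξ
  have hNi : ∀ u ∈ U, ∀ i, pd i (fun v => ((0, n v) : Minkowski)) u = f.Z i u
      - ((f.Z i u).1 / lam u) • f.Y u - (f.ξ u).1 • pd i (fun v => nullLift (x v)) u := by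
    intro u hu i
    rw [pd_congr hUo hu hN, pd_sub (dξ u hu) ((dξ u hu).fst.fun_smul (dNy u hu)),
      pd_smul (dξ u hu).fst (dNy u hu), pd_fst (dξ u hu), hξi u hu, hy u hu, smul_smul]
    module
  -- By the previous formula the first form is `Ω² / (λ² m)`, and `Ω²` is `m * E` times the
  -- identity. So `E` reappears as the conformal factor of `λ² I`.
  have hI : ∀ u ∈ U, ∀ i j, firstForm x u i j = if i = j then E u / lam u ^ 2 else 0 := by
    intro u hu i j
    have hm := (hd.pos_m u (hUD hu)).ne'
    have hl := lam0 u hu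
    have hE := hd.sq_add_sq (hUD hu)
    have h := ha u hu
    have h4 : ∀ i, lorentz (f.Z i u) (f.Y u) = 0 := fun i => by rw [lorentz_comm, h.Y_Z]
    rw [firstForm_eq (dx u hu), hα u hu, hα u hu]
    simp only [lorentz_sub_left, lorentz_sub_right, lorentz_smul_left, lorentz_smul_right, h.Y_Y,
      h.Y_Z, h4, h.Z_Z]
    fin_cases i <;> fin_cases j <;> simp [hd.Ω_one_zero (hUD hu), hd.Ω_one_one (hUD hu)] <;>
      field_simp <;> linarith
  have hII : ∀ u ∈ U, ∀ i j, secondForm x n u i j =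
      Ω u i j / lam u + (f.ξ u).1 * firstForm x u i j := by
    intro u hu i j
    have hm := (hd.pos_m u (hUD hu)).ne'
    have hl := lam0 u hu
    have h := ha u hu
    have h4 : ∀ i, lorentz (f.Z i u) (f.Y u) = 0 := fun i => by rw [lorentz_comm, h.Y_Z]
    have hyZ : lorentz (pd i (fun v => nullLift (x v)) u) (f.Z j u) = -(Ω u i j / lam u) := by
      rw [hα u hu]
      simp only [lorentz_sub_left, lorentz_smul_left, h.Y_Z, h.Z_Z]
      fin_cases j <;> simp <;> field_simp
    have hyY : lorentz (pd i (fun v => nullLift (x v)) u) (f.Y u) = 0 := by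
      rw [hα u hu]
      simp [lorentz_sub_left, lorentz_smul_left, h.Y_Y, h4]
    rw [secondForm_eq (dx u hu) (dn u hu), hNi u hu, firstForm_eq (dx u hu)]
    simp only [lorentz_sub_right, lorentz_smul_right, hyZ, hyY]
    ring
  -- In the formula for `II` the part `Ω / λ` is traceless, so the coefficient of `I` is the mean
  -- curvature.
  have hH : ∀ u ∈ U, meanCurvature x n u = (f.ξ u).1 := by
    intro u hu
    have hE := hd.pos_E u (hUD hu)
    have hl := lam0 u hu
    have hI' : firstForm x u = (E u / lam u ^ 2) • (1 : Matrix (Fin 2) (Fin 2) ℝ) := by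
      ext i j
      rw [hI u hu]
      simp [Matrix.one_apply]
    have hinv : (firstForm x u)⁻¹ = (lam u ^ 2 / E u) • (1 : Matrix (Fin 2) (Fin 2) ℝ) := by
      refine Matrix.inv_eq_right_inv ?_
      rw [hI', smul_mul_smul_comm, mul_one]
      have : E u / lam u ^ 2 * (lam u ^ 2 / E u) = 1 := by field_simp
      rw [this, one_smul]
    rw [meanCurvature, hinv, smul_mul_assoc, one_mul, Matrix.trace_smul, Matrix.trace_fin_two,
      hII u hu, hII u hu, hI u hu, hI u hu, hd.Ω_one_one (hUD hu)]
    simp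
    field_simp
    ring
  have hIIo : ∀ u ∈ U, tracelessSecondForm x n u = (lam u)⁻¹ • Ω u := by
    intro u hu
    ext i j
    rw [tracelessSecondForm, Matrix.sub_apply, Matrix.smul_apply, hII u hu, hH u hu]
    simp
    ring
  have hCG : ∀ u ∈ U, conformalGauss x n u = f.ξ u := by
    intro u hu
    rw [conformalGauss, hH u hu, hN u hu]
    abel
  have hCGi : ∀ u ∈ U, ∀ i, pd i (conformalGauss x n) u = f.Z i u := by
    intro u hu i
    rw [pd_congr hUo hu hCG, hξi u hu]
  have hys : ∀ u ∈ U, nullLift (xs u) = (f.Ys u).1⁻¹ • f.Ys u := fun u hu =>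
    nullLift_toSphere (ha u hu).Ys_Ys (hYs u hu)
  have hscale : ∀ u ∈ U, (lam u * (f.Ys u).1) • nullLift (xs u) = lam u • f.Ys u := by
    intro u hu
    have := (hYs u hu).ne'
    rw [hys u hu, smul_smul, mul_assoc, mul_inv_cancel₀ this, mul_one]
  -- The product `-1` of `Y` and `Y*` determines `1 - x · xs`, which is the normalizing denominator
  -- of `y*`.
  have hyStar : ∀ u ∈ U, yStar x xs u = lam u • f.Ys u := by
    intro u hu
    have h1 := lam0 u hu
    have h2 := (hYs u hu).ne'
    have h3 := lorentz_nullLift (x u) (xs u)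
    rw [hy u hu, hys u hu, lorentz_smul_left, lorentz_smul_right, (ha u hu).Y_Ys] at h3
    rw [← hscale u hu, yStar]
    congr 1
    have : 1 - ⟪(x u : E4), (xs u : E4)⟫_ℝ = (lam u)⁻¹ * (f.Ys u).1⁻¹ := by linarith
    rw [this]
    field_simp
  have hxdx : ∀ u ∈ U, lorentz (f.ξ u) (nullLift (x u)) = 0 := fun u hu => by
    rw [hy u hu, lorentz_smul_right, lorentz_comm, (ha u hu).Y_ξ, mul_zero]
  have hξdx : ∀ u ∈ U, ∀ i, lorentz (f.ξ u) (pd i (fun v => nullLift (x v)) u) = 0 := by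
    intro u hu i
    rw [hα u hu]
    simp [lorentz_sub_right, lorentz_smul_right, lorentz_comm (f.ξ u) (f.Y u), (ha u hu).Y_ξ,
      (ha u hu).ξ_Z]
  have hydy : ∀ u ∈ U, ∀ i, lorentz (nullLift (x u)) (pd i (fun v => nullLift (x v)) u) = 0 := by
    intro u hu i
    rw [hα u hu, hy u hu]
    simp [lorentz_sub_right, lorentz_smul_right, lorentz_smul_left, (ha u hu).Y_Y, (ha u hu).Y_Z]
  have hEpos : ∀ u ∈ U, 0 < E u / lam u ^ 2 := fun u hu =>
    div_pos (hd.pos_E u (hUD hu)) (pow_pos (hY u hu) 2)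
  refine ⟨⟨sx, sn, ?_, ?_, ?_, ?_⟩, ?_, slam, hY, h0, ?_, ?_, ?_, xs, ⟨sxs, ?_⟩, ?_⟩
  · intro u hu
    refine linearIndependent_of_ne_zero_of_inner_eq_zero (fun i hi => ?_) fun i j hij => ?_
    · have := hI u hu i i
      rw [firstForm, Matrix.of_apply, hi] at this
      simp at this
      exact (hEpos u hu).ne this
    · have := hI u hu i j
      rwa [if_neg hij] at this
  · intro u hu
    have : lorentz ((0, n u) : Minkowski) (0, n u) = 1 := by
      rw [hN u hu]
      simp only [lorentz_sub_left, lorentz_sub_right, lorentz_smul_left, lorentz_smul_right,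
        lorentz_nullLift_self, lorentz_comm (nullLift (x u)) (f.ξ u), hxdx u hu, (ha u hu).ξ_ξ]
      ring
    rw [lorentz_self] at this
    exact (pow_eq_one_iff_of_nonneg (norm_nonneg _) two_ne_zero).1 (by simpa using this)
  · intro u hu
    have : lorentz ((0, n u) : Minkowski) (nullLift (x u)) = 0 := by
      rw [hN u hu]
      simp only [lorentz_sub_left, lorentz_smul_left, lorentz_nullLift_self, hxdx u hu]
      ring
    simpa [lorentz, nullLift] using this
  · intro u hu i
    have : lorentz ((0, n u) : Minkowski) (pd i (fun v => nullLift (x v)) u) = 0 := by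
      rw [hN u hu]
      simp only [lorentz_sub_left, lorentz_smul_left, hydy u hu, hξdx u hu]
      ring
    rw [pd_nullLift (dx u hu)] at this
    simpa [lorentz] using this
  · intro u hu hzero
    rw [hIIo u hu, smul_eq_zero_iff_right (inv_ne_zero (lam0 u hu))] at hzero
    have hE := hd.sq_add_sq (hUD hu)
    rw [hzero] at hE
    simp at hE
    exact hE.elim (hd.pos_m u (hUD hu)).ne' (hd.pos_E u (hUD hu)).ne'
  · intro u hu
    rw [hIIo u hu, smul_smul, mul_inv_cancel₀ (lam0 u hu), one_smul]
  · intro u hu i j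
    rw [hCGi u hu, hCGi u hu, (ha u hu).Z_Z]
  · intro u hu i
    have hl := lam0 u hu
    have hm := (hd.pos_m u (hUD hu)).ne'
    have hE := (hd.pos_E u (hUD hu)).ne'
    have hinv : (tracelessSecondForm x n u)⁻¹ = (lam u / (m u * E u)) • Ω u := by
      rw [hIIo u hu, hd.inv_smul_Ω (hUD hu) hl]
    have hHi : ∀ j, pd j (meanCurvature x n) u = (f.Z j u).1 := fun j => by
      rw [pd_congr hUo hu hH, pd_fst (dξ u hu), hξi u hu]
    -- Time component of the structure equation for `Y`. The time components of the `Z` are the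
    -- derivatives of `H`, so this is the required formula for `w`.
    have hlami : pd i lam u = -(w u i * lam u) - Ω u i 0 / m u * (f.Z 0 u).1
        - Ω u i 1 / m u * (f.Z 1 u).1 := by
      rw [hlam, pd_fst (dY u hu), hf.pd_Y u hu]
      simp
    rw [hinv, pd_log (dlam u hu) hl, hlami]
    simp only [hHi, Matrix.mulVec, dotProduct, Fin.sum_univ_two, hI u hu, Matrix.smul_apply,
      smul_eq_mul]
    fin_cases i <;> simp <;> field_simp <;> ring
  · intro u hu
    refine ⟨lam u * (f.Ys u).1, mul_pos (hY u hu) (hYs u hu), ?_⟩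
    rw [hscale u hu, hCG u hu, hy u hu]
    have h := ha u hu
    have hl := lam0 u hu
    refine ⟨?_, ?_, ?_, fun i => ?_⟩
    · rw [lorentz_smul_left, lorentz_smul_right, lorentz_comm, h.Y_Ys]
      field_simp
    · rw [lorentz_smul_left, lorentz_smul_right, h.Ys_Ys, mul_zero, mul_zero]
    · rw [lorentz_smul_left, h.Ys_ξ, mul_zero]
    · rw [lorentz_smul_left, hCGi u hu, h.Ys_Z, mul_zero]
  · intro u hu i j
    have h := ha u hu
    have hl := lam0 u hu
    have hm := (hd.pos_m u (hUD hu)).ne'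
    have h5 : ∀ i, lorentz (f.Z i u) (f.Ys u) = 0 := fun i => by rw [lorentz_comm, h.Ys_Z]
    rw [hCGi u hu, pd_congr hUo hu hyStar,
      pd_smul (dlam u hu) (differentiableAt_of_contDiffOn hUo hf.smooth_Ys hu), hf.pd_Ys u hu]
    simp only [lorentz_add_right, lorentz_sub_right, lorentz_smul_right, h5, h.Z_Z]
    fin_cases i <;> simp <;> field_simp

end Existence

/-! ### The frame of a surface that realizes the data. -/

section FrameOfSurface

variable {U D : Set Plane} {Ω : Plane → Matrix (Fin 2) (Fin 2) ℝ} {m E : Plane → ℝ}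
  {w : Plane → Fin 2 → ℝ} {Ωs : Plane → Matrix (Fin 2) (Fin 2) ℝ} {x xs : Plane → S3}
  {n : Plane → E4} {lam : Plane → ℝ}

theorem contDiffOn_inner {F : Type*} [NormedAddCommGroup F] [InnerProductSpace ℝ F]
    {f g : Plane → F} (hf : ContDiffOn ℝ ∞ f U) (hg : ContDiffOn ℝ ∞ g U) :
    ContDiffOn ℝ ∞ (fun u => ⟪f u, g u⟫_ℝ) U :=
  hf.inner ℝ hg

theorem IsSurface.contDiffOn_meanCurvature (hU : IsOpen U) (hs : IsSurface U x n) :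
    ContDiffOn ℝ ∞ (meanCurvature x n) U := by
  have hI : ∀ i j, ContDiffOn ℝ ∞ (fun u => firstForm x u i j) U := fun i j =>
    contDiffOn_inner (contDiffOn_pd hU hs.smooth_x i) (contDiffOn_pd hU hs.smooth_x j)
  have hII : ∀ i j, ContDiffOn ℝ ∞ (fun u => secondForm x n u i j) U := fun i j =>
    (contDiffOn_inner (contDiffOn_pd hU hs.smooth_x i) (contDiffOn_pd hU hs.smooth_n j)).neg
  have hdet : ∀ u ∈ U, firstForm x u 0 0 * firstForm x u 1 1
      - firstForm x u 0 1 * firstForm x u 1 0 ≠ 0 := fun u hu => by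
    rw [← Matrix.det_fin_two]
    exact (Matrix.posDef_gram_of_linearIndependent (hs.immersion u hu)).det_pos.ne'
  have hH : ∀ u ∈ U, meanCurvature x n u = 1 / 2 *
      ((firstForm x u 1 1 * secondForm x n u 0 0 - firstForm x u 0 1 * secondForm x n u 1 0
        - firstForm x u 1 0 * secondForm x n u 0 1 + firstForm x u 0 0 * secondForm x n u 1 1) /
      (firstForm x u 0 0 * firstForm x u 1 1 - firstForm x u 0 1 * firstForm x u 1 0)) := by
    intro u _
    rw [meanCurvature, Matrix.inv_def, Matrix.adjugate_fin_two, Matrix.det_fin_two,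
      Ring.inverse_eq_inv', Matrix.trace_fin_two, Matrix.mul_apply, Matrix.mul_apply,
      Fin.sum_univ_two, Fin.sum_univ_two]
    simp
    ring
  refine ContDiffOn.congr ?_ hH
  exact contDiffOn_const.mul ((((((hI 1 1).mul (hII 0 0)).sub ((hI 0 1).mul (hII 1 0))).sub
    ((hI 1 0).mul (hII 0 1))).add ((hI 0 0).mul (hII 1 1))).div
    (((hI 0 0).mul (hI 1 1)).sub ((hI 0 1).mul (hI 1 0))) hdet)

/-- The normalization against `y` forces the unknown scale to be `1 / (1 - x · xs)`, so the vector
in the definition is `yStar`. -/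
theorem IsConformalTransform.lorentz_yStar (h : IsConformalTransform U x n xs) {u : Plane}
    (hu : u ∈ U) : 0 < 1 - ⟪(x u : E4), (xs u : E4)⟫_ℝ ∧
    lorentz (yStar x xs u) (nullLift (x u)) = -1 ∧
    lorentz (yStar x xs u) (yStar x xs u) = 0 ∧
    lorentz (yStar x xs u) (conformalGauss x n u) = 0 ∧
    ∀ i, lorentz (yStar x xs u) (pd i (conformalGauss x n) u) = 0 := by
  obtain ⟨μ, hμ, h1, h2⟩ := h.exists_scale u hu
  have h3 := h1
  rw [lorentz_smul_left, lorentz_nullLift, real_inner_comm] at h3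
  have h4 : 1 - ⟪(x u : E4), (xs u : E4)⟫_ℝ = 1 / μ := by
    field_simp
    linarith
  have h5 : yStar x xs u = μ • nullLift (xs u) := by
    rw [yStar, h4, one_div_one_div]
  rw [h5, h4]
  exact ⟨by positivity, h1, h2⟩

/-- The moving frame of a surface scaled by the factor `lam`. -/
def surfaceFrame (x xs : Plane → S3) (n : Plane → E4) (lam : Plane → ℝ) : MovingFrame where
  Y u := lam u • nullLift (x u)
  Ys u := (lam u)⁻¹ • yStar x xs u
  ξ := conformalGauss x n
  Z i := pd i (conformalGauss x n)

theorem IsSurface.contDiffOn_conformalGauss (hU : IsOpen U) (hs : IsSurface U x n) :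
    ContDiffOn ℝ ∞ (conformalGauss x n) U :=
  ((hs.contDiffOn_meanCurvature hU).smul (contDiffOn_nullLift hs.smooth_x)).add
    (contDiffOn_const.prodMk hs.smooth_n)

theorem IsConformalTransform.contDiffOn_yStar (hs : IsSurface U x n)
    (h : IsConformalTransform U x n xs) : ContDiffOn ℝ ∞ (yStar x xs) U :=
  (contDiffOn_const.div (contDiffOn_const.sub (contDiffOn_inner hs.smooth_x h.smooth))
    fun _ hu => (h.lorentz_yStar hu).1.ne').smul (contDiffOn_nullLift h.smooth)

theorem lorentz_nullLift_pd (hU : IsOpen U) (hx : ContDiffOn ℝ ∞ (fun u => (x u : E4)) U)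
    {u : Plane} (hu : u ∈ U) (i : Fin 2) :
    lorentz (nullLift (x u)) (pd i (fun v => nullLift (x v)) u) = 0 := by
  have := lorentz_pd_of_const hU (contDiffOn_nullLift hx) (contDiffOn_nullLift hx)
    (fun v _ => lorentz_nullLift_self (x v)) hu i
  rw [lorentz_comm] at this
  linarith

/-- The multiple `H y` in `ξ` is invisible here, since `y` is null and orthogonal to `y`, `dy` and
`(0, n)`; what remains are the properties of the unit normal. -/
theorem IsSurface.lorentz_normal (hU : IsOpen U) (hs : IsSurface U x n) {u : Plane} (hu : u ∈ U) :
    lorentz (conformalGauss x n u) (nullLift (x u)) = 0 ∧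
    lorentz (conformalGauss x n u) (conformalGauss x n u) = 1 ∧
    ∀ i, lorentz (conformalGauss x n u) (pd i (fun v => nullLift (x v)) u) = 0 := by
  have hx := differentiableAt_of_contDiffOn hU hs.smooth_x hu
  have h1 : lorentz ((0, n u) : Minkowski) (nullLift (x u)) = 0 := by
    simpa [lorentz, nullLift] using hs.n_perp_x u hu
  have h2 : lorentz ((0, n u) : Minkowski) (0, n u) = 1 := by
    simp [lorentz_self, hs.norm_n u hu]
  have h3 : ∀ i, lorentz ((0, n u) : Minkowski) (pd i (fun v => nullLift (x v)) u) = 0 := fun i => by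
    rw [pd_nullLift hx]
    simpa [lorentz] using hs.n_perp_dx u hu i
  refine ⟨?_, ?_, fun i => ?_⟩
  · simp [conformalGauss, lorentz_add_left, lorentz_smul_left, lorentz_nullLift_self, h1]
  · simp [conformalGauss, lorentz_add_left, lorentz_smul_left, lorentz_add_right,
      lorentz_smul_right, lorentz_nullLift_self, h1, h2, lorentz_comm (nullLift (x u)) (0, n u)]
  · simp [conformalGauss, lorentz_add_left, lorentz_smul_left, lorentz_nullLift_pd hU hs.smooth_x hu,
      h3]

/-- The term with `dH` is a multiple of `y`, which is orthogonal to `dy`, so only `H I - II`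
survives. -/
theorem IsSurface.lorentz_pd_pd (hU : IsOpen U) (hs : IsSurface U x n) {u : Plane} (hu : u ∈ U)
    (i j : Fin 2) : lorentz (pd i (fun v => nullLift (x v)) u) (pd j (conformalGauss x n) u) =
      -tracelessSecondForm x n u i j := by
  have dx := differentiableAt_of_contDiffOn hU hs.smooth_x hu
  have dn := differentiableAt_of_contDiffOn hU hs.smooth_n hu
  have dy := differentiableAt_of_contDiffOn hU (contDiffOn_nullLift hs.smooth_x) hu
  have dH := differentiableAt_of_contDiffOn hU (hs.contDiffOn_meanCurvature hU) hu
  have dN : DifferentiableAt ℝ (fun v => ((0, n v) : Minkowski)) u :=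
    (differentiableAt_const _).prodMk dn
  have : pd j (conformalGauss x n) u = pd j (meanCurvature x n) u • nullLift (x u)
      + meanCurvature x n u • pd j (fun v => nullLift (x v)) u
      + pd j (fun v => ((0, n v) : Minkowski)) u := by
    unfold conformalGauss
    rw [pd_add (dH.fun_smul dy) dN, pd_smul dH dy]
  rw [this]
  simp only [lorentz_add_right, lorentz_smul_right, tracelessSecondForm, Matrix.sub_apply,
    Matrix.smul_apply, firstForm_eq dx, secondForm_eq dx dn, smul_eq_mul,
    lorentz_comm _ (nullLift (x u)), lorentz_nullLift_pd hU hs.smooth_x hu]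
  ring

theorem Realizes.isAdapted {p₀ : Plane} (hU : IsOpen U) (hr : Realizes U p₀ Ω m w Ωs x n lam)
    (ht : IsConformalTransform U x n xs) {u : Plane} (hu : u ∈ U) :
    (surfaceFrame x xs n lam).IsAdapted m u := by
  have hs := hr.surface
  have hl := (hr.pos_lam u hu).ne'
  obtain ⟨-, t1, t2, t3, t4⟩ := ht.lorentz_yStar hu
  obtain ⟨n1, n2, n3⟩ := hs.lorentz_normal hU hu
  have sξ := hs.contDiffOn_conformalGauss hU
  have sy := contDiffOn_nullLift hs.smooth_x
  constructor
  case Y_Y => simp [surfaceFrame, lorentz_smul_left, lorentz_smul_right, lorentz_nullLift_self]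
  case Ys_Ys => simp [surfaceFrame, lorentz_smul_left, lorentz_smul_right, t2]
  case Y_Ys =>
    simp [surfaceFrame, lorentz_smul_left, lorentz_smul_right, lorentz_comm (nullLift _), t1, hl]
  case Y_ξ => simp [surfaceFrame, lorentz_smul_left, lorentz_comm (nullLift _), n1]
  case Ys_ξ => simp [surfaceFrame, lorentz_smul_left, t3]
  case ξ_ξ => exact n2
  case Y_Z =>
    intro i
    have := lorentz_pd_of_const hU sξ sy (fun v hv => (hs.lorentz_normal hU hv).1) hu i
    rw [n3] at this
    simp [surfaceFrame, lorentz_smul_left, lorentz_comm (nullLift _), this]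
  case Ys_Z => intro i; simp [surfaceFrame, lorentz_smul_left, t4]
  case ξ_Z =>
    intro i
    have := lorentz_pd_of_const hU sξ sξ (fun v hv => (hs.lorentz_normal hU hv).2.1) hu i
    rw [lorentz_comm] at this
    change lorentz (conformalGauss x n u) (pd i (conformalGauss x n) u) = 0
    linarith
  case Z_Z => exact hr.mobius_eq u hu

/-- Reduces each structure equation to the five products of a derivative with the frame. -/
theorem eq_of_transition {f : MovingFrame} {u : Plane} (hm : m u ≠ 0) (hf : f.IsAdapted m u)
    {v : Minkowski} {a b c d e : ℝ} (ha : lorentz (f.Ys u) v = a) (hb : lorentz (f.Y u) v = b)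
    (hc : lorentz (f.ξ u) v = c) (hd : lorentz (f.Z 0 u) v = d) (he : lorentz (f.Z 1 u) v = e) :
    v = -(a • f.Y u) - b • f.Ys u + c • f.ξ u + (d / m u) • f.Z 0 u + (e / m u) • f.Z 1 u := by
  rw [← ha, ← hb, ← hc, ← hd, ← he]
  exact (hf.transition_self hm v).symm

/-- The frame of a surface that realizes the data solves the structure equations. -/
theorem Realizes.isSolution {p₀ : Plane} (hU : IsOpen U) (hd : IsData D Ω m E w Ωs) (hUD : U ⊆ D)
    (hr : Realizes U p₀ Ω m w Ωs x n lam) (ht : IsConformalTransform U x n xs)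
    (hΩs : ∀ u ∈ U, ∀ i j, Ωs u i j =
      -((lam u)⁻¹ * lorentz (pd i (conformalGauss x n) u) (pd j (yStar x xs) u))) :
    (surfaceFrame x xs n lam).IsSolution U Ω m w Ωs := by
  have hs := hr.surface
  have hl : ∀ u ∈ U, lam u ≠ 0 := fun u hu => (hr.pos_lam u hu).ne'
  have sξ := hs.contDiffOn_conformalGauss hU
  have sy := contDiffOn_nullLift hs.smooth_x
  have sys := ht.contDiffOn_yStar hs
  have slam := hr.smooth_lam
  set f := surfaceFrame x xs n lam with hf
  have sY : ContDiffOn ℝ ∞ f.Y U := slam.smul sy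
  have sYs : ContDiffOn ℝ ∞ f.Ys U := (slam.inv hl).smul sys
  have sξ' : ContDiffOn ℝ ∞ f.ξ U := sξ
  have sZ : ∀ i, ContDiffOn ℝ ∞ (f.Z i) U := contDiffOn_pd hU sξ
  have ha : ∀ u ∈ U, f.IsAdapted m u := fun u hu => hr.isAdapted hU ht hu
  have hm : ∀ u ∈ U, m u ≠ 0 := fun u hu => (hd.pos_m u (hUD hu)).ne'
  have hYi : ∀ u ∈ U, ∀ i, pd i f.Y u =
      pd i lam u • nullLift (x u) + lam u • pd i (fun v => nullLift (x v)) u := fun u hu i =>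
    pd_smul (differentiableAt_of_contDiffOn hU slam hu) (differentiableAt_of_contDiffOn hU sy hu) i
  have hYsi : ∀ u ∈ U, ∀ i, pd i f.Ys u =
      pd i (fun v => (lam v)⁻¹) u • yStar x xs u + (lam u)⁻¹ • pd i (yStar x xs) u := fun u hu i =>
    pd_smul ((differentiableAt_of_contDiffOn hU slam hu).fun_inv (hl u hu))
      (differentiableAt_of_contDiffOn hU sys hu) i
  have hyZ : ∀ u ∈ U, ∀ i j, lorentz (f.Z j u) (pd i (fun v => nullLift (x v)) u) =
      -(Ω u i j / lam u) := fun u hu i j => by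
    rw [lorentz_comm]
    refine (hs.lorentz_pd_pd hU hu i j).trans ?_
    have := hl u hu
    rw [hr.Ω_eq u hu, Matrix.smul_apply, smul_eq_mul]
    field_simp
  have hy : ∀ u ∈ U, nullLift (x u) = (lam u)⁻¹ • f.Y u := fun u hu => by
    have := hl u hu
    simp [hf, surfaceFrame, smul_smul, this]
  have hys : ∀ u ∈ U, yStar x xs u = lam u • f.Ys u := fun u hu => by
    have := hl u hu
    simp [hf, surfaceFrame, smul_smul, this]
  have hYZ : ∀ u ∈ U, ∀ i j, lorentz (f.Z j u) (pd i f.Y u) = -Ω u i j := fun u hu i j => by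
    have := hl u hu
    rw [hYi u hu, lorentz_add_right, lorentz_smul_right, lorentz_smul_right, hyZ u hu, hy u hu,
      lorentz_smul_right, lorentz_comm (f.Z j u) (f.Y u), (ha u hu).Y_Z]
    field_simp
    ring
  have hYsZ : ∀ u ∈ U, ∀ i j, lorentz (f.Z j u) (pd i f.Ys u) = -Ωs u j i := fun u hu i j => by
    have := hl u hu
    rw [hYsi u hu, lorentz_add_right, lorentz_smul_right, lorentz_smul_right, hys u hu,
      lorentz_smul_right, lorentz_comm (f.Z j u) (f.Ys u), (ha u hu).Ys_Z, hΩs u hu]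
    simp [hf, surfaceFrame]
  have hyi : ∀ u ∈ U, ∀ i, pd i (fun v => nullLift (x v)) u =
      -(lorentz (f.Ys u) (pd i (fun v => nullLift (x v)) u) • f.Y u)
        - (Ω u i 0 / (lam u * m u)) • f.Z 0 u - (Ω u i 1 / (lam u * m u)) • f.Z 1 u := by
    intro u hu i
    have h1 : lorentz (f.Y u) (pd i (fun v => nullLift (x v)) u) = 0 := by
      change lorentz (lam u • nullLift (x u)) _ = 0
      rw [lorentz_smul_left, lorentz_nullLift_pd hU hs.smooth_x hu, mul_zero]
    have h2 : lorentz (f.ξ u) (pd i (fun v => nullLift (x v)) u) = 0 :=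
      (hs.lorentz_normal hU hu).2.2 i
    have h3 := eq_of_transition (hm u hu) (ha u hu) rfl h1 h2 (hyZ u hu i 0) (hyZ u hu i 1)
    have := hl u hu
    have := hm u hu
    refine h3.trans ?_
    match_scalars <;> field_simp
    ring
  have hI : ∀ u ∈ U, ∀ i j, firstForm x u i j = if i = j then E u / lam u ^ 2 else 0 := by
    intro u hu i j
    have hm := hm u hu
    have hl := hl u hu
    have hE := hd.sq_add_sq (hUD hu)
    have h := ha u hu
    have h4 : ∀ i, lorentz (f.Z i u) (f.Y u) = 0 := fun i => by rw [lorentz_comm, h.Y_Z]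
    rw [firstForm_eq (differentiableAt_of_contDiffOn hU hs.smooth_x hu), hyi u hu i, hyi u hu j]
    simp only [lorentz_sub_left, lorentz_sub_right, lorentz_smul_left, lorentz_smul_right,
      lorentz_neg_left, lorentz_neg_right, h.Y_Y, h.Y_Z, h4, h.Z_Z]
    fin_cases i <;> fin_cases j <;> simp [hd.Ω_one_zero (hUD hu), hd.Ω_one_one (hUD hu)] <;>
      field_simp <;> linarith
  have hHi : ∀ u ∈ U, ∀ i, (f.Z i u).1 = pd i (meanCurvature x n) u := fun u hu i => by
    have h1 : (fun v => (f.ξ v).1) = meanCurvature x n := by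
      funext v
      simp [hf, surfaceFrame, conformalGauss, nullLift]
    rw [← h1, pd_fst (differentiableAt_of_contDiffOn hU sξ' hu)]
    rfl
  -- The derivative of `(1, x)` has zero time component. In its expansion this determines the one
  -- unknown coefficient through the time components `λ` of `Y` and `dH` of the `Z`.
  have hysyi : ∀ u ∈ U, ∀ i, lorentz (f.Ys u) (pd i (fun v => nullLift (x v)) u) =
      -((Ω u i 0 * pd 0 (meanCurvature x n) u + Ω u i 1 * pd 1 (meanCurvature x n) u)
        / (lam u ^ 2 * m u)) := by
    intro u hu i
    have hm := hm u hu
    have hl := hl u hu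
    have h1 := congrArg Prod.fst (hyi u hu i)
    rw [pd_nullLift (differentiableAt_of_contDiffOn hU hs.smooth_x hu)] at h1
    have h2 : (f.Y u).1 = lam u := by simp [hf, surfaceFrame, nullLift]
    simp only [Prod.fst_sub, Prod.fst_neg, Prod.smul_fst, smul_eq_mul, h2, hHi u hu] at h1
    rw [pd_nullLift (differentiableAt_of_contDiffOn hU hs.smooth_x hu)]
    field_simp at h1 ⊢
    linarith
  -- The derivative of `λ` contributes `-d log λ`. The product just computed gives the `dH` term,
  -- because `I` times the inverse of the traceless second form is `Ω / (λ m)`.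
  have hYsY : ∀ u ∈ U, ∀ i, lorentz (f.Ys u) (pd i f.Y u) = w u i := by
    intro u hu i
    have hm := hm u hu
    have hE := (hd.pos_E u (hUD hu)).ne'
    have hl' := hl u hu
    have hIIo : tracelessSecondForm x n u = (lam u)⁻¹ • Ω u := by
      rw [hr.Ω_eq u hu, smul_smul, inv_mul_cancel₀ hl', one_smul]
    rw [hYi u hu, lorentz_add_right, lorentz_smul_right, lorentz_smul_right, hysyi u hu, hy u hu,
      lorentz_smul_right, lorentz_comm (f.Ys u) (f.Y u), (ha u hu).Y_Ys, hr.w_eq u hu i, hIIo,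
      hd.inv_smul_Ω (hUD hu) hl', pd_log (differentiableAt_of_contDiffOn hU slam hu) hl']
    simp only [Matrix.mulVec, dotProduct, Fin.sum_univ_two, hI u hu, Matrix.smul_apply, smul_eq_mul]
    fin_cases i <;> simp <;> field_simp <;> ring
  refine ⟨sY, sYs, sξ', sZ, fun u hu i => ?_, fun u hu i => ?_, fun u hu i => rfl,
    fun u hu i j => ?_⟩
  · have h1 : lorentz (f.Y u) (pd i f.Y u) = 0 := by
      have := lorentz_pd_of_const hU sY sY (fun v hv => (ha v hv).Y_Y) hu i
      rw [lorentz_comm] at this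
      linarith
    have h2 : lorentz (f.ξ u) (pd i f.Y u) = 0 := by
      have := lorentz_pd_of_const hU sY sξ' (fun v hv => (ha v hv).Y_ξ) hu i
      rw [lorentz_comm, this]
      exact neg_eq_zero.2 ((ha u hu).Y_Z i)
    refine (eq_of_transition (hm u hu) (ha u hu) (hYsY u hu i) h1 h2 (hYZ u hu i 0)
      (hYZ u hu i 1)).trans ?_
    module
  · have h1 : lorentz (f.Ys u) (pd i f.Ys u) = 0 := by
      have := lorentz_pd_of_const hU sYs sYs (fun v hv => (ha v hv).Ys_Ys) hu i
      rw [lorentz_comm] at this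
      linarith
    have h2 : lorentz (f.ξ u) (pd i f.Ys u) = 0 := by
      have := lorentz_pd_of_const hU sYs sξ' (fun v hv => (ha v hv).Ys_ξ) hu i
      rw [lorentz_comm, this]
      exact neg_eq_zero.2 ((ha u hu).Ys_Z i)
    have h3 : lorentz (f.Y u) (pd i f.Ys u) = -w u i := by
      have := lorentz_pd_of_const hU sY sYs (fun v hv => (ha v hv).Y_Ys) hu i
      rw [lorentz_comm, hYsY u hu] at this
      linarith
    refine (eq_of_transition (hm u hu) (ha u hu) h1 h3 h2 (hYsZ u hu i 0) (hYsZ u hu i 1)).trans ?_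
    module
  · have h1 : lorentz (f.Y u) (pd i (f.Z j) u) = Ω u j i := by
      have := lorentz_pd_of_const hU sY (sZ j) (fun v hv => (ha v hv).Y_Z j) hu i
      rw [lorentz_comm, hYZ u hu, (hd.symm_Ω u (hUD hu)).apply] at this
      linarith
    have h2 : lorentz (f.Ys u) (pd i (f.Z j) u) = Ωs u j i := by
      have := lorentz_pd_of_const hU sYs (sZ j) (fun v hv => (ha v hv).Ys_Z j) hu i
      rw [lorentz_comm, hYsZ u hu] at this
      linarith
    have h3 : lorentz (f.ξ u) (pd i (f.Z j) u) = -(if i = j then m u else 0) := by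
      have := lorentz_pd_of_const hU sξ' (sZ j) (fun v hv => (ha v hv).ξ_Z j) hu i
      rw [← (ha u hu).Z_Z i j]
      change lorentz (f.Z i u) (f.Z j u) = _ at this
      linarith
    have hsym : ∀ k l, pd k (f.Z l) u = pd l (f.Z k) u := fun k l => pd_comm hU sξ hu k l
    have hprod : ∀ k l p, lorentz (pd k (f.Z l) u) (f.Z p u) + lorentz (f.Z l u) (pd k (f.Z p) u) =
        if l = p then pd k m u else 0 := by
      intro k l p
      rw [← pd_lorentz (differentiableAt_of_contDiffOn hU (sZ l) hu)
        (differentiableAt_of_contDiffOn hU (sZ p) hu),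
        pd_congr hU hu (fun v hv => (ha v hv).Z_Z l p)]
      split_ifs
      · rfl
      · exact pd_const 0 k
    -- Koszul's argument: the `Z` have Gram matrix `m δ` and `pd k (Z l)` is symmetric in `k` and
    -- `l`, so three cyclic product rules give the Christoffel symbols of `m |du|²`.
    have h4 : ∀ k, lorentz (f.Z k u) (pd i (f.Z j) u) = m u * christoffel m k j i u := by
      intro k
      have e1 := hprod i j k
      have e2 := hprod j k i
      have e3 := hprod k i j
      rw [lorentz_comm] at e1 e2 e3
      rw [hsym i k] at e1
      rw [hsym j i] at e2
      rw [hsym k j] at e3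
      have := hm u hu
      simp only [lorentz_comm (f.Z j u), lorentz_comm (f.Z i u), lorentz_comm (f.Z k u)] at e1 e2 e3 ⊢
      have e4 : lorentz (pd i (f.Z j) u) (f.Z k u) = ((if j = k then pd i m u else 0)
          + (if k = i then pd j m u else 0) - (if i = j then pd k m u else 0)) / 2 := by
        linarith
      rw [e4, christoffel]
      simp only [eq_comm (a := k) (b := i), eq_comm (a := j) (b := i)]
      field_simp
      ring
    refine (eq_of_transition (hm u hu) (ha u hu) h2 h1 h3 (h4 0) (h4 1)).trans ?_
    rw [mul_div_cancel_left₀ _ (hm u hu), mul_div_cancel_left₀ _ (hm u hu)]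
    module

end FrameOfSurface

/-! ### Orthochronous Lorentz maps act conformally on the sphere. -/

section Conformal

/-- The action on affine sphere coordinates of a linear map of Minkowski space. -/
def projectiveAction (T : Minkowski →L[ℝ] Minkowski) (z : E4) : E4 :=
  (T (1, z)).1⁻¹ • (T (1, z)).2

theorem hasFDerivAt_lift (T : Minkowski →L[ℝ] Minkowski) (z : E4) :
    HasFDerivAt (fun z : E4 => T (1, z)) (T ∘L ContinuousLinearMap.inr ℝ ℝ E4) z :=
  T.hasFDerivAt.comp z (hasFDerivAt_prodMk_right (1 : ℝ) z)

theorem contDiffAt_projectiveAction {T : Minkowski →L[ℝ] Minkowski} {z : E4}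
    (h : (T (1, z)).1 ≠ 0) : ContDiffAt ℝ ∞ (projectiveAction T) z := by
  have hT : ContDiffAt ℝ ∞ (fun z : E4 => T (1, z)) z :=
    (T.contDiff.comp (contDiff_const.prodMk contDiff_id)).contDiffAt
  exact (hT.fst.inv h).smul hT.snd

/-- The quotient rule, kept in Minkowski space: up to scale the differential is `T`, corrected by a
multiple of `T (1, z)`, which is null when `z` lies on the sphere and `T` is an isometry. -/
theorem fderiv_projectiveAction {T : Minkowski →L[ℝ] Minkowski} {z : E4}
    (h : (T (1, z)).1 ≠ 0) (v : E4) :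
    ((0, fderiv ℝ (projectiveAction T) z v) : Minkowski) =
      (T (1, z)).1⁻¹ • T (0, v) - ((T (0, v)).1 / (T (1, z)).1 ^ 2) • T (1, z) := by
  have h1 := hasFDerivAt_lift T z
  have h2 : HasFDerivAt (projectiveAction T) _ z :=
    HasFDerivAt.fun_smul ((hasDerivAt_inv h).comp_hasFDerivAt z h1.fst) h1.snd
  rw [h2.fderiv]
  ext1
  · simp
    field_simp
    ring
  · simp
    module

theorem sphere_fact_finrank : Fact (Module.finrank ℝ E4 = 3 + 1) := ⟨by simp⟩

theorem nullLift_injective : Function.Injective nullLift := fun _ _ h =>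
  Subtype.ext (congrArg Prod.snd h)

theorem toSphere_smul_nullLift {c : ℝ} (hc : 0 < c) (p : S3) : toSphere (c • nullLift p) = p := by
  have h1 : lorentz (c • nullLift p) (c • nullLift p) = 0 := by
    simp [lorentz_smul_left, lorentz_smul_right, lorentz_nullLift_self]
  have h2 : (c • nullLift p).1 = c := by simp [nullLift]
  apply nullLift_injective
  rw [nullLift_toSphere h1 (by rwa [h2]), h2, smul_smul, inv_mul_cancel₀ hc.ne', one_smul]

/-- A Lorentz transformation that keeps one future null vector in the future cone keeps all of them
there. -/
theorem time_pos_of_isometry {T : Minkowski ≃ₗ[ℝ] Minkowski}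
    (hT : ∀ v w, lorentz (T v) (T w) = lorentz v w) {p : S3} (hp : 0 < (T (nullLift p)).1)
    (q : S3) : 0 < (T (nullLift q)).1 := by
  have hnull : ∀ q, ‖(T (nullLift q)).2‖ ^ 2 = (T (nullLift q)).1 ^ 2 := fun q => by
    have := hT (nullLift q) (nullLift q)
    rw [lorentz_nullLift_self, lorentz_self] at this
    linarith
  have hpq := hT (nullLift p) (nullLift q)
  rw [lorentz_nullLift] at hpq
  by_contra hq
  push Not at hq
  have hq0 : (T (nullLift q)).1 ≠ 0 := fun h0 => by
    have h1 := hnull q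
    rw [h0] at h1
    have h2 : T (nullLift q) = 0 := Prod.ext h0 (by simpa using h1)
    have h3 := congrArg Prod.fst ((LinearEquiv.map_eq_zero_iff T).1 h2)
    simp [nullLift] at h3
  have hq' : (T (nullLift q)).1 < 0 := lt_of_le_of_ne hq hq0
  have n1 : ‖(T (nullLift p)).2‖ = (T (nullLift p)).1 :=
    (pow_left_inj₀ (norm_nonneg _) hp.le two_ne_zero).1 (hnull p)
  have n2 : ‖(T (nullLift q)).2‖ = -(T (nullLift q)).1 :=
    (pow_left_inj₀ (norm_nonneg _) (by linarith) two_ne_zero).1 (by rw [hnull q]; ring)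
  -- If the time components had opposite signs, Cauchy–Schwarz would make the product of the images
  -- nonnegative, while it equals `p · q - 1 ≤ 0`. Then `p · q = 1` and `p = q`, a contradiction.
  have hcs := neg_le_of_abs_le (abs_real_inner_le_norm (T (nullLift p)).2 (T (nullLift q)).2)
  rw [n1, n2] at hcs
  have hle : ⟪(p : E4), (q : E4)⟫_ℝ ≤ 1 := by
    have := real_inner_le_norm (p : E4) (q : E4)
    simpa using this
  have heq : ⟪(p : E4), (q : E4)⟫_ℝ = 1 := by
    simp only [lorentz] at hpq
    nlinarith
  have hpq' : p = q := (sphere_ext_iff p q).2 heq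
  rw [hpq'] at hp
  linarith

/-- The map of the sphere induced by a linear map of Minkowski space. -/
def sphereMap (T : Minkowski ≃ₗ[ℝ] Minkowski) (q : S3) : S3 := toSphere (T (nullLift q))

variable {T : Minkowski ≃ₗ[ℝ] Minkowski}

theorem nullLift_sphereMap (hT : ∀ v w, lorentz (T v) (T w) = lorentz v w)
    (hpos : ∀ q, 0 < (T (nullLift q)).1) (q : S3) :
    nullLift (sphereMap T q) = (T (nullLift q)).1⁻¹ • T (nullLift q) :=
  nullLift_toSphere (by rw [hT, lorentz_nullLift_self]) (hpos q)

theorem coe_sphereMap (hT : ∀ v w, lorentz (T v) (T w) = lorentz v w)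
    (hpos : ∀ q, 0 < (T (nullLift q)).1) (q : S3) :
    (sphereMap T q : E4) = projectiveAction T.toContinuousLinearEquiv (q : E4) :=
  coe_toSphere (by rw [hT, lorentz_nullLift_self]) (hpos q)

theorem sphereMap_symm_sphereMap (hT : ∀ v w, lorentz (T v) (T w) = lorentz v w)
    (hpos : ∀ q, 0 < (T (nullLift q)).1) (q : S3) : sphereMap T.symm (sphereMap T q) = q := by
  rw [sphereMap, nullLift_sphereMap hT hpos, map_smul, LinearEquiv.symm_apply_apply]
  exact toSphere_smul_nullLift (inv_pos.2 (hpos q)) q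

theorem contMDiff_sphereMap (hT : ∀ v w, lorentz (T v) (T w) = lorentz v w)
    (hpos : ∀ q, 0 < (T (nullLift q)).1) : ContMDiff (𝓡 3) (𝓡 3) ∞ (sphereMap T) := by
  have := sphere_fact_finrank
  have h1 : ContMDiff (𝓡 3) 𝓘(ℝ, E4) ∞ fun q : S3 => (sphereMap T q : E4) := by
    intro q
    have h2 : (fun q : S3 => (sphereMap T q : E4)) =
        projectiveAction T.toContinuousLinearEquiv ∘ fun q : S3 => (q : E4) :=
      funext fun q => coe_sphereMap hT hpos q
    rw [h2]
    exact (contDiffAt_projectiveAction (hpos q).ne').contMDiffAt.comp q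
      (contMDiff_coe_sphere (n := 3) q)
  exact h1.codRestrict_sphere fun q => (sphereMap T q).2

/-- The diffeomorphism of the sphere induced by an orthochronous Lorentz transformation. -/
def sphereDiffeomorph (T : Minkowski ≃ₗ[ℝ] Minkowski)
    (hT : ∀ v w, lorentz (T v) (T w) = lorentz v w) (hpos : ∀ q, 0 < (T (nullLift q)).1)
    (hT' : ∀ v w, lorentz (T.symm v) (T.symm w) = lorentz v w)
    (hpos' : ∀ q, 0 < (T.symm (nullLift q)).1) : S3 ≃ₘ⟮𝓡 3, 𝓡 3⟯ S3 where
  toFun := sphereMap T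
  invFun := sphereMap T.symm
  left_inv := sphereMap_symm_sphereMap hT hpos
  right_inv := sphereMap_symm_sphereMap (T := T.symm) hT' hpos'
  contMDiff_toFun := contMDiff_sphereMap hT hpos
  contMDiff_invFun := contMDiff_sphereMap hT' hpos'

theorem inner_mvfderiv_coe (p : S3) (v : TangentSpace (𝓡 3) p) :
    ⟪(p : E4), mvfderiv (𝓡 3) (fun q : S3 => (q : E4)) p v⟫_ℝ = 0 := by
  have := sphere_fact_finrank
  have h := range_mvfderiv_subtypeVal (n := 3) p
  have hv : mvfderiv (𝓡 3) (fun q : S3 => (q : E4)) p v ∈ (Submodule.span ℝ {(p : E4)})ᗮ :=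
    h ▸ LinearMap.mem_range_self _ v
  exact Submodule.mem_orthogonal_singleton_iff_inner_right.1 hv

/-- The correction term in the differential lies along the null vector `T (1, p)`, which is
orthogonal to the images of tangent vectors. It drops out, leaving the factor given by the inverse
square of the time component. -/
theorem isConformal_of_sphereMap (hT : ∀ v w, lorentz (T v) (T w) = lorentz v w)
    (hpos : ∀ q, 0 < (T (nullLift q)).1) (φ : S3 ≃ₘ⟮𝓡 3, 𝓡 3⟯ S3) (hφ : ∀ q, φ q = sphereMap T q) :
    IsConformal φ := by
  have := sphere_fact_finrank
  intro p
  set L : Minkowski →L[ℝ] Minkowski := (T.toContinuousLinearEquiv : Minkowski →L[ℝ] Minkowski)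
  have hb : (L (1, (p : E4))).1 ≠ 0 := (hpos p).ne'
  have hLT : ∀ v w, lorentz (L v) (L w) = lorentz v w := hT
  have hcomp : (fun q : S3 => (φ q : E4)) = projectiveAction L ∘ fun q : S3 => (q : E4) :=
    funext fun q => by rw [hφ]; exact coe_sphereMap hT hpos q
  have hd : ∀ v : TangentSpace (𝓡 3) p, mvfderiv (𝓡 3) (fun q : S3 => (φ q : E4)) p v =
      fderiv ℝ (projectiveAction L) p (mvfderiv (𝓡 3) (fun q : S3 => (q : E4)) p v) := by
    intro v
    have h1 : MDifferentiableAt (𝓡 3) 𝓘(ℝ, E4) (fun q : S3 => (q : E4)) p :=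
      (contMDiff_coe_sphere (n := 3) p).mdifferentiableAt one_ne_zero
    have h2 : MDifferentiableAt 𝓘(ℝ, E4) 𝓘(ℝ, E4) (projectiveAction L) (p : E4) :=
      (contDiffAt_projectiveAction hb).contMDiffAt.mdifferentiableAt (by simp)
    rw [hcomp]
    simp only [mvfderiv, mfderiv_comp (I' := 𝓘(ℝ, E4)) p h2 h1, mfderiv_eq_fderiv]
    rfl
  refine ⟨(L (1, (p : E4))).1⁻¹ ^ 2, by positivity, fun v w => ?_⟩
  rw [hd, hd]
  set a := mvfderiv (𝓡 3) (fun q : S3 => (q : E4)) p v with ha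
  set c := mvfderiv (𝓡 3) (fun q : S3 => (q : E4)) p w with hc
  have ha0 : ⟪(p : E4), a⟫_ℝ = 0 := inner_mvfderiv_coe p v
  have hc0 : ⟪(p : E4), c⟫_ℝ = 0 := inner_mvfderiv_coe p w
  have hl : ∀ a c : E4, ⟪a, c⟫_ℝ = lorentz (0, a) (0, c) := fun a c => by simp [lorentz]
  rw [hl (fderiv ℝ (projectiveAction L) p a), fderiv_projectiveAction hb, fderiv_projectiveAction hb]
  simp only [lorentz_sub_left, lorentz_sub_right, lorentz_smul_left, lorentz_smul_right, hLT]
  have e1 : lorentz (1, (p : E4)) (1, (p : E4)) = 0 := lorentz_nullLift_self p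
  have e2 : lorentz (1, (p : E4)) (0, c) = 0 := by simp [lorentz, hc0]
  have e3 : lorentz (0, a) (1, (p : E4)) = 0 := by
    rw [lorentz_comm]
    simp [lorentz, ha0]
  rw [e1, e2, e3, hl a c]
  ring

/-- A Lorentz transformation that maps some future null vector to a future one induces a conformal
transformation of the sphere. -/
theorem exists_conformal_of_isometry (hT : ∀ v w, lorentz (T v) (T w) = lorentz v w) {p : S3}
    (hp : 0 < (T (nullLift p)).1) :
    ∃ φ : S3 ≃ₘ⟮𝓡 3, 𝓡 3⟯ S3, IsConformal φ ∧ ∀ q, φ q = toSphere (T (nullLift q)) := by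
  have hpos := time_pos_of_isometry hT hp
  have hT' : ∀ v w, lorentz (T.symm v) (T.symm w) = lorentz v w := fun v w => by
    rw [← hT, LinearEquiv.apply_symm_apply, LinearEquiv.apply_symm_apply]
  -- The image of `p` is a future direction which the inverse maps back to the future, so the
  -- inverse is orthochronous too.
  have hp' : 0 < (T.symm (nullLift (sphereMap T p))).1 := by
    rw [nullLift_sphereMap hT hpos, map_smul, LinearEquiv.symm_apply_apply]
    simpa [nullLift] using hp
  have hpos' := time_pos_of_isometry hT' hp'
  let φ := sphereDiffeomorph T hT hpos hT' hpos'
  exact ⟨φ, isConformal_of_sphereMap hT hpos φ fun _ => rfl, fun _ => rfl⟩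

end Conformal

/-! ### Uniqueness up to conformal transformations. -/

section Uniqueness

variable {U D : Set Plane} {Ω : Plane → Matrix (Fin 2) (Fin 2) ℝ} {m E : Plane → ℝ}
  {w : Plane → Fin 2 → ℝ} {Ωs : Plane → Matrix (Fin 2) (Fin 2) ℝ}

/-- The linear isomorphism carrying one adapted frame to another one. -/
def frameEquiv {m : Plane → ℝ} {u : Plane} (hm : m u ≠ 0) {f g : MovingFrame}
    (hf : f.IsAdapted m u) (hg : g.IsAdapted m u) : Minkowski ≃ₗ[ℝ] Minkowski :=
  LinearEquiv.ofLinearMap (f.combination u ∘ₗ g.coordinates m u) (g.combination u ∘ₗ f.coordinates m u)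
    (LinearMap.ext fun v => by
      simp only [LinearMap.comp_apply, hg.coordinates_combination hm, LinearMap.id_apply]
      rw [combination_coordinates, hf.transition_self hm])
    (LinearMap.ext fun v => by
      simp only [LinearMap.comp_apply, hf.coordinates_combination hm, LinearMap.id_apply]
      rw [combination_coordinates, hg.transition_self hm])

theorem frameEquiv_apply {m : Plane → ℝ} {u : Plane} (hm : m u ≠ 0) {f g : MovingFrame}
    (hf : f.IsAdapted m u) (hg : g.IsAdapted m u) (v : Minkowski) :
    frameEquiv hm hf hg v = transition m f g v u :=
  combination_coordinates f g u v

theorem MovingFrame.IsAdapted.lorentz_combination {u : Plane} {f : MovingFrame}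
    (hf : f.IsAdapted m u) (c d : Fin 5 → ℝ) :
    lorentz (f.combination u c) (f.combination u d) =
      -(c 0 * d 1) - c 1 * d 0 + c 2 * d 2 + m u * (c 3 * d 3 + c 4 * d 4) := by
  have h1 : lorentz (f.Ys u) (f.Y u) = -1 := by rw [lorentz_comm, hf.Y_Ys]
  have h2 : lorentz (f.ξ u) (f.Y u) = 0 := by rw [lorentz_comm, hf.Y_ξ]
  have h3 : lorentz (f.ξ u) (f.Ys u) = 0 := by rw [lorentz_comm, hf.Ys_ξ]
  have h4 : ∀ i, lorentz (f.Z i u) (f.Y u) = 0 := fun i => by rw [lorentz_comm, hf.Y_Z]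
  have h5 : ∀ i, lorentz (f.Z i u) (f.Ys u) = 0 := fun i => by rw [lorentz_comm, hf.Ys_Z]
  have h6 : ∀ i, lorentz (f.Z i u) (f.ξ u) = 0 := fun i => by rw [lorentz_comm, hf.ξ_Z]
  simp [combination, lorentz_add_left, lorentz_smul_left, lorentz_add_right, lorentz_smul_right,
    hf.Y_Y, hf.Ys_Ys, hf.Y_Ys, hf.Y_ξ, hf.Ys_ξ, hf.ξ_ξ, hf.Y_Z, hf.Ys_Z, hf.ξ_Z, hf.Z_Z, h1, h2, h3,
    h4, h5, h6]
  ring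

/-- Both frames have the same Gram matrix, so the products on the two sides are the same function of
the coordinates. -/
theorem lorentz_frameEquiv {u : Plane} (hm : m u ≠ 0) {f g : MovingFrame}
    (hf : f.IsAdapted m u) (hg : g.IsAdapted m u) (v v' : Minkowski) :
    lorentz (frameEquiv hm hf hg v) (frameEquiv hm hf hg v') = lorentz v v' := by
  have key : ∀ v, v = g.combination u (g.coordinates m u v) := fun v => by
    rw [combination_coordinates, hg.transition_self hm]
  change lorentz (f.combination u (g.coordinates m u v)) (f.combination u (g.coordinates m u v')) = _
  conv_rhs => rw [key v, key v']
  rw [hf.lorentz_combination, hg.lorentz_combination]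

theorem transition_Y {u : Plane} {f g : MovingFrame} (hg : g.IsAdapted m u) :
    transition m f g (g.Y u) u = f.Y u := by
  simp [transition, lorentz_comm _ (g.Y u), hg.Y_Y, hg.Y_Ys, hg.Y_ξ, hg.Y_Z]

/-- Two surfaces that realize the same data over a connected open set differ by a conformal
transformation of the sphere. -/
theorem Realizes.exists_conformal (hU : IsOpen U) (hUc : IsPreconnected U)
    (hd : IsData D Ω m E w Ωs) (hUD : U ⊆ D) {p₀ : Plane} (hp₀ : p₀ ∈ U) {x x' : Plane → S3}
    {n n' : Plane → E4} {lam lam' : Plane → ℝ} (hr : Realizes U p₀ Ω m w Ωs x n lam)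
    (hr' : Realizes U p₀ Ω m w Ωs x' n' lam') :
    ∃ φ : S3 ≃ₘ⟮𝓡 3, 𝓡 3⟯ S3, IsConformal φ ∧ ∀ u ∈ U, x' u = φ (x u) := by
  obtain ⟨xs, ht, hΩs⟩ := hr.Ωs_eq
  obtain ⟨xs', ht', hΩs'⟩ := hr'.Ωs_eq
  set g := surfaceFrame x xs n lam with hg
  set f := surfaceFrame x' xs' n' lam' with hf
  have hgs : g.IsSolution U Ω m w Ωs := hr.isSolution hU hd hUD ht hΩs
  have hfs : f.IsSolution U Ω m w Ωs := hr'.isSolution hU hd hUD ht' hΩs'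
  have hga : ∀ u ∈ U, g.IsAdapted m u := fun u hu => hr.isAdapted hU ht hu
  have hfa : ∀ u ∈ U, f.IsAdapted m u := fun u hu => hr'.isAdapted hU ht' hu
  have hm : m p₀ ≠ 0 := (hd.pos_m p₀ (hUD hp₀)).ne'
  set T := frameEquiv hm (hfa p₀ hp₀) (hga p₀ hp₀) with hTdef
  -- `T` is built at `p₀`, but the transition is constant on the connected set, so `T` carries `Y`
  -- to `Y'` at every point.
  have hTY : ∀ u ∈ U, T (nullLift (x u)) = (lam' u / lam u) • nullLift (x' u) := by
    intro u hu
    have h1 : T (g.Y u) = f.Y u := by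
      rw [hTdef, frameEquiv_apply, transition_const hU hUc hd hUD hfs hgs _ hp₀ hu,
        transition_Y (hga u hu)]
    have h2 : lam u • T (nullLift (x u)) = lam' u • nullLift (x' u) := by
      rw [← map_smul]
      exact h1
    rw [div_eq_inv_mul, ← smul_smul, ← h2, smul_smul, inv_mul_cancel₀ (hr.pos_lam u hu).ne',
      one_smul]
  have hc : ∀ u ∈ U, 0 < lam' u / lam u := fun u hu => div_pos (hr'.pos_lam u hu) (hr.pos_lam u hu)
  obtain ⟨φ, hφ, hφT⟩ := exists_conformal_of_isometry (T := T) (p := x p₀)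
    (lorentz_frameEquiv hm (hfa p₀ hp₀) (hga p₀ hp₀))
    (by rw [hTY p₀ hp₀]; simpa [nullLift] using hc p₀ hp₀)
  refine ⟨φ, hφ, fun u hu => ?_⟩
  rw [hφT, hTY u hu, toSphere_smul_nullLift (hc u hu)]

end Uniqueness

end

end ConformalSurface

/-! ### The main theorem. -/

theorem theorem3p2 (D : Set Plane) (hDo : IsOpen D) (hDc : IsConnected D)
    (Ω : Plane → Matrix (Fin 2) (Fin 2) ℝ) (m E : Plane → ℝ)
    (w : Plane → Fin 2 → ℝ) (Ωs : Plane → Matrix (Fin 2) (Fin 2) ℝ)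
    (hdata : IsData D Ω m E w Ωs)
    (hint : ∀ u ∈ D, IntegrabilityConditions Ω m E w Ωs u)
    (p₀ : Plane) (hp₀ : p₀ ∈ D) :
    (∃ D₀ : Set Plane, IsOpen D₀ ∧ IsConnected D₀ ∧ p₀ ∈ D₀ ∧ D₀ ⊆ D ∧
      ∃ (x : Plane → S3) (n : Plane → E4) (lam : Plane → ℝ),
        Realizes D₀ p₀ Ω m w Ωs x n lam) ∧
    (∀ D₀ : Set Plane, IsOpen D₀ → IsConnected D₀ → p₀ ∈ D₀ → D₀ ⊆ D →
      ∀ (x x' : Plane → S3) (n n' : Plane → E4) (lam lam' : Plane → ℝ),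
        Realizes D₀ p₀ Ω m w Ωs x n lam → Realizes D₀ p₀ Ω m w Ωs x' n' lam' →
        ∃ φ : S3 ≃ₘ⟮𝓡 3, 𝓡 3⟯ S3, IsConformal φ ∧ ∀ u ∈ D₀, x' u = φ (x u)) := by
  refine ⟨?_, fun D₀ hD₀ hc hp hsub x x' n n' lam lam' hr hr' =>
    hr.exists_conformal hD₀ hc.isPreconnected hdata hsub hp hr'⟩
  obtain ⟨ρ, hρ, hsub, f, hf, ha, hY, hYs⟩ := exists_adapted_solution hDo hdata hint hp₀
  have hmem : Metric.ball p₀ ρ ∈ nhds p₀ := Metric.ball_mem_nhds p₀ hρ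
  -- The time components are 1 and `1 / 2` at `p₀`; a smaller ball keeps both null vectors future
  -- directed.
  have e1 : ∀ᶠ u in nhds p₀, 0 < (f.Y u).1 :=
    (hf.smooth_Y.continuousOn.continuousAt hmem).fst.eventually (lt_mem_nhds (by simp [hY]))
  have e2 : ∀ᶠ u in nhds p₀, 0 < (f.Ys u).1 :=
    (hf.smooth_Ys.continuousOn.continuousAt hmem).fst.eventually (lt_mem_nhds (by simp [hYs]))
  obtain ⟨δ, hδ, hball⟩ := Metric.eventually_nhds_iff_ball.1 ((e1.and e2).and hmem)
  have hsub' : Metric.ball p₀ δ ⊆ Metric.ball p₀ ρ := fun u hu => (hball u hu).2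
  refine ⟨Metric.ball p₀ δ, Metric.isOpen_ball,
    (convex_ball p₀ δ).isConnected ⟨p₀, Metric.mem_ball_self hδ⟩, Metric.mem_ball_self hδ,
    hsub'.trans hsub, _, _, _, realizes_of_adapted_solution Metric.isOpen_ball hdata
      (hsub'.trans hsub) (hf.mono hsub') (fun u hu => ha u (hsub' hu))
      (fun u hu => (hball u hu).1.1) (fun u hu => (hball u hu).1.2) hY⟩
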